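/- Consider the $\lambda$-calculus with dynamically generated prompts, whose expressions, values and evaluation contexts are $$e ::= v \mid e\,e \mid \mathcal{P}x.e \mid \#_v\,e \mid \mathcal{G}_v x.e \mid v\triangleleft e,\qquad v ::= x \mid \lambda x.e \mid p \mid \ulcorner E\urcorner,\qquad E ::= \square \mid E\,e \mid v\,E \mid \#_p\,E$$ ($x$ ranges over variables, $p$ over prompts; $\lambda x.e$, $\mathcal{P}x.e$ and $\mathcal{G}_vx.e$ bind $x$ in $e$; terms are taken up to $\alpha$-equivalence). Write $\mathrm{fv}$ for free variables, $\#(m)$ for the set of prompts occurring in $m$, and $\mathrm{sp}(E)$ for the set of prompts $p$ with $E=E_1[\#_p E_2]$ for some $E_1,E_2$. Reduction is given by $(\lambda x.e)\,v\to e\{v/x\}$; $\;\#_p v\to v$; $\;\#_p E[\mathcal{G}_p x.e]\to e\{\ulcorner E\urcorner/x\}$ if $p\notin\mathrm{sp}(E)$; $\;\ulcorner E\urcorner\triangleleft e\to E[e]$; $\;\mathcal{P}x.e\to e\{p/x\}$ if $p\notin\#(e)$; and $E[e_1]\to E[e_2]$ if $e_1\to e_2$ and $(\#(e_2)\setminus\#(e_1))\cap\#(E)=\emptyset$.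 A normal form is control-stuck if it is $E[\mathcal{G}_px.e]$ with $p\notin\mathrm{sp}(E)$, and an error if it is neither a value nor control-stuck. *Contextual equivalence.* Closed $e_1,e_2$ are contextually equivalent if for every closed evaluation context $E$ with $\#(E)=\emptyset$: $E[e_1]$ reduces (in zero or more steps) to a value iff $E[e_2]$ does, to a control-stuck term iff $E[e_2]$ does, and diverges or reduces to an error iff $E[e_2]$ does. *$\star$-bisimilarity.* Multi-hole contexts are $C ::= C_v \mid C\,C \mid \mathcal{P}x.C \mid \#_{C_v}C \mid \mathcal{G}_{C_v}x.C \mid C_v\triangleleft C \mid \star_i[C]$, $\;C_v ::= x \mid \lambda x.C \mid \ulcorner\mathbb{E}\urcorner \mid \square_i$, $\;\mathbb{E} ::= \square \mid \mathbb{E}\,C \mid C_v\,\mathbb{E} \mid \#_{\square_i}\mathbb{E} \mid \star_i[\mathbb{E}]$. For a finite sequence $\Gamma$ of closed values, $C[\Gamma]$ replaces $\square_i$ by $\Gamma_i$ (a prompt, in $\#_{\square_i}\mathbb{E}$) and $\star_i[C]$ by $E[C[\Gamma]]$, where $\Gamma_i=\ulcorner E\urcorner$; likewise for $C_v,\mathbb{E}$.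 States are pairs $(\Gamma,e)$ with $e$ closed; a state $(\Gamma,v)$ is identified with the sequence $\Gamma,v$, and sequences of values, possibly empty, are states. With closed contexts as labels, the transitions are: - $(\Gamma,e_1)\xrightarrow{\tau}(\Gamma,e_2)$ if $e_1\to e_2$ and $(\#(e_2)\setminus\#(e_1))\cap\#(\Gamma)=\emptyset$; - $\Gamma\xrightarrow{\lambda,i,C_v}(\Gamma,e\{C_v[\Gamma]/x\})$ if $\Gamma_i=\lambda x.e$; - $\Gamma\xrightarrow{\mathrm{val}}\Gamma$; - $\Gamma\xrightarrow{\ulcorner\cdot\urcorner,i,C_v}(\Gamma,E[C_v[\Gamma]])$ if $\Gamma_i=\ulcorner E\urcorner$; - $\Gamma\xrightarrow{\ulcorner\cdot\urcorner,i,j}(\Gamma,\ulcorner E_1\urcorner,\ulcorner E_2\urcorner)$ if $\Gamma_i=\ulcorner E_1[\#_pE_2]\urcorner$, $\Gamma_j=p$ and $p\notin\mathrm{sp}(E_2)$; - $\Gamma\xrightarrow{\#,i,j}\Gamma$ if $\Gamma_i=\Gamma_j=p$ is a prompt; - $\Gamma\xrightarrow{\#}(\Gamma,p)$ if $p\notin\#(\Gamma)$;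 - $(\Gamma,E[\mathcal{G}_px.e])\xrightarrow{\mathbb{E}}(\Gamma,e')$ if $p\notin\mathrm{sp}(E)$ and, for $t=\mathbb{E}[\Gamma][E[\mathcal{G}_px.e]]$, either $t\to e'$, or $t$ is a normal form and $e'=t$. Let $\Rightarrow$ be the reflexive-transitive closure of $\xrightarrow{\tau}$, and let $\overset{a}{\Rightarrow}$ be $\Rightarrow$ if $a=\tau$, and $\Rightarrow\xrightarrow{a}\Rightarrow$ otherwise. A $\star$-bisimulation is a relation $\mathcal{R}$ on states such that $s\,\mathcal{R}\,t$ and $s\xrightarrow{a}s'$ imply $t\overset{a}{\Rightarrow}t'$ and $s'\,\mathcal{R}\,t'$ for some $t'$, and conversely for the transitions of $t$. (The distinction between passive and active transitions, which matters for up-to techniques, is immaterial here, since both lead back to $\mathcal{R}$.) The relation $\star$-bisimilarity is the union of all $\star$-bisimulations; closed expressions $e_1,e_2$ are called $\star$-bisimilar if the states $(\emptyset,e_1)$ and $(\emptyset,e_2)$ are. **Statement ($\beta_\Omega$ axiom).** Let $E$ be an evaluation context with $\mathrm{sp}(E)=\emptyset$, $x\notin\mathrm{fv}(E)$ a variable,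 and $e$ an expression. 1. If $E$ and $e$ are closed, then $(\lambda x.E[x])\,e$ and $E[e]$ are $\star$-bisimilar, and they are contextually equivalent. 2. In general, for every finite sequence of variables $\vec{x}$ that contains all the free variables of $E$ and $e$, the closed expressions $\lambda\vec{x}.((\lambda x.E[x])\,e)$ and $\lambda\vec{x}.E[e]$ are $\star$-bisimilar, and they are contextually equivalent. -/

import Mathlib

/-! A call-by-value lambda-calculus with delimited control and dynamic prompt generation.

Term variables and prompts are natural numbers. Terms are taken up to alpha-equivalence by using
de Bruijn indices: the binding constructors `lam`, `gen`, `grab` bind index `0`, and the indices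
that point beyond all enclosing binders are the free variables. -/

namespace PromptCalc

mutual
/-- Expressions `e`. -/
inductive Expr : Type
  | val (v : Val)
  | app (e₁ e₂ : Expr)
  /-- generation of a new prompt, bound in `e` -/
  | gen (e : Expr)
  /-- `e` delimited by `v` -/
  | reset (v : Val) (e : Expr)
  /-- capture of the context up to the delimiter `v`; the continuation is bound in `e` -/
  | grab (v : Val) (e : Expr)
  /-- `e` thrown to the continuation `v` -/
  | push (v : Val) (e : Expr)
/-- Values `v`. -/
inductive Val : Type
  | var (n : ℕ)
  | lam (e : Expr)
  | prompt (p : ℕ)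
  | cont (E : ECtx)
/-- Evaluation contexts `E`, interpreted outside-in. -/
inductive ECtx : Type
  | hole
  | appL (E : ECtx) (e : Expr)
  | appR (v : Val) (E : ECtx)
  | reset (p : ℕ) (E : ECtx)
end

/-! ### Variables, renaming and capture-avoiding substitution -/

mutual
/-- Free variables. -/
def Expr.fv : Expr → Set ℕ
  | .val v => v.fv
  | .app e₁ e₂ => e₁.fv ∪ e₂.fv
  | .gen e => {n | n + 1 ∈ e.fv}
  | .reset v e => v.fv ∪ e.fv
  | .grab v e => v.fv ∪ {n | n + 1 ∈ e.fv}
  | .push v e => v.fv ∪ e.fv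
def Val.fv : Val → Set ℕ
  | .var n => {n}
  | .lam e => {n | n + 1 ∈ e.fv}
  | .prompt _ => ∅
  | .cont E => E.fv
def ECtx.fv : ECtx → Set ℕ
  | .hole => ∅
  | .appL E e => E.fv ∪ e.fv
  | .appR v E => v.fv ∪ E.fv
  | .reset _ E => E.fv
end

/-- A renaming, pushed under a binder. -/
def upRen (f : ℕ → ℕ) : ℕ → ℕ
  | 0 => 0
  | n + 1 => f n + 1

mutual
def Expr.rename (f : ℕ → ℕ) : Expr → Expr
  | .val v => .val (v.rename f)
  | .app e₁ e₂ => .app (e₁.rename f) (e₂.rename f)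
  | .gen e => .gen (e.rename (upRen f))
  | .reset v e => .reset (v.rename f) (e.rename f)
  | .grab v e => .grab (v.rename f) (e.rename (upRen f))
  | .push v e => .push (v.rename f) (e.rename f)
def Val.rename (f : ℕ → ℕ) : Val → Val
  | .var n => .var (f n)
  | .lam e => .lam (e.rename (upRen f))
  | .prompt p => .prompt p
  | .cont E => .cont (E.rename f)
def ECtx.rename (f : ℕ → ℕ) : ECtx → ECtx
  | .hole => .hole
  | .appL E e => .appL (E.rename f) (e.rename f)
  | .appR v E => .appR (v.rename f) (E.rename f)
  | .reset p E => .reset p (E.rename f)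
end

/-- A simultaneous substitution, pushed under a binder. -/
def upSubst (s : ℕ → Val) : ℕ → Val
  | 0 => .var 0
  | n + 1 => (s n).rename Nat.succ

mutual
def Expr.subst (s : ℕ → Val) : Expr → Expr
  | .val v => .val (v.subst s)
  | .app e₁ e₂ => .app (e₁.subst s) (e₂.subst s)
  | .gen e => .gen (e.subst (upSubst s))
  | .reset v e => .reset (v.subst s) (e.subst s)
  | .grab v e => .grab (v.subst s) (e.subst (upSubst s))
  | .push v e => .push (v.subst s) (e.subst s)
def Val.subst (s : ℕ → Val) : Val → Val
  | .var n => s n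
  | .lam e => .lam (e.subst (upSubst s))
  | .prompt p => .prompt p
  | .cont E => .cont (E.subst s)
def ECtx.subst (s : ℕ → Val) : ECtx → ECtx
  | .hole => .hole
  | .appL E e => .appL (E.subst s) (e.subst s)
  | .appR v E => .appR (v.subst s) (E.subst s)
  | .reset p E => .reset p (E.subst s)
end

/-- The substitution that replaces index `0` by `v` and removes the binder. -/
def single (v : Val) : ℕ → Val
  | 0 => v
  | n + 1 => .var n

/-- `e{v/x}`, where `x` is the variable bound by the binder of which `e` is the body. -/
def Expr.inst (e : Expr) (v : Val) : Expr := e.subst (single v)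

/-- The abstraction `λx.e` of the (named) free variable `x` in `e`: `x` becomes the bound index
`0`, every other free variable is kept. -/
def lamVar (x : ℕ) (e : Expr) : Val :=
  .lam (e.rename (fun y => if y = x then 0 else y + 1))

/-- The iterated abstraction `λx₁. … λxₙ.e`; it is `e` for the empty sequence. -/
def lamVars : List ℕ → Expr → Expr
  | [], e => e
  | x :: xs, e => .val (lamVar x (lamVars xs e))

/-! ### Prompts and evaluation contexts -/

mutual
/-- The prompts that occur in a term. -/
def Expr.prompts : Expr → Set ℕ
  | .val v => v.prompts
  | .app e₁ e₂ => e₁.prompts ∪ e₂.prompts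
  | .gen e => e.prompts
  | .reset v e => v.prompts ∪ e.prompts
  | .grab v e => v.prompts ∪ e.prompts
  | .push v e => v.prompts ∪ e.prompts
def Val.prompts : Val → Set ℕ
  | .var _ => ∅
  | .lam e => e.prompts
  | .prompt p => {p}
  | .cont E => E.prompts
def ECtx.prompts : ECtx → Set ℕ
  | .hole => ∅
  | .appL E e => E.prompts ∪ e.prompts
  | .appR v E => v.prompts ∪ E.prompts
  | .reset p E => {p} ∪ E.prompts
end

/-- Prompts of a finite sequence of values. -/
def envPrompts (Γ : List Val) : Set ℕ := {p | ∃ v ∈ Γ, p ∈ v.prompts}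

/-- `E[e]`. -/
def ECtx.plug : ECtx → Expr → Expr
  | .hole, e => e
  | .appL E e', e => .app (E.plug e) e'
  | .appR v E, e => .app (.val v) (E.plug e)
  | .reset p E, e => .reset (.prompt p) (E.plug e)

/-- `E[E']`. -/
def ECtx.comp : ECtx → ECtx → ECtx
  | .hole, E' => E'
  | .appL E e, E' => .appL (E.comp E') e
  | .appR v E, E' => .appR v (E.comp E')
  | .reset p E, E' => .reset p (E.comp E')

/-- The surrounding prompts of `E`, i.e. the prompts guarding its hole. -/
def ECtx.surPr (E : ECtx) : Set ℕ := {p | ∃ E₁ E₂ : ECtx, E = E₁.comp (.reset p E₂)}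

/-! ### Reduction -/

/-- One-step reduction. -/
inductive Red : Expr → Expr → Prop
  | beta (e : Expr) (v : Val) : Red (.app (.val (.lam e)) (.val v)) (e.inst v)
  | resetVal (p : ℕ) (v : Val) : Red (.reset (.prompt p) (.val v)) (.val v)
  | capture (p : ℕ) (E : ECtx) (e : Expr) (hp : p ∉ E.surPr) :
      Red (.reset (.prompt p) (E.plug (.grab (.prompt p) e))) (e.inst (.cont E))
  | throw (E : ECtx) (e : Expr) : Red (.push (.cont E) e) (E.plug e)
  | gen (e : Expr) (p : ℕ) (hp : p ∉ e.prompts) : Red (.gen e) (e.inst (.prompt p))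
  | compat (E : ECtx) (e₁ e₂ : Expr) (h : Red e₁ e₂)
      (hfresh : (e₂.prompts \ e₁.prompts) ∩ E.prompts = ∅) : Red (E.plug e₁) (E.plug e₂)

def Reds : Expr → Expr → Prop := Relation.ReflTransGen Red

def NormalForm (e : Expr) : Prop := ¬ ∃ e', Red e e'

def Expr.IsValue (e : Expr) : Prop := ∃ v : Val, e = .val v

/-- Control-stuck terms `E[grab p x. e']` with `p` not surrounding the hole of `E`. -/
def Expr.IsStuck (e : Expr) : Prop :=
  ∃ (E : ECtx) (p : ℕ) (e' : Expr), p ∉ E.surPr ∧ e = E.plug (.grab (.prompt p) e')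

/-- Errors: the normal forms that are neither values nor control-stuck. -/
def Expr.IsError (e : Expr) : Prop := NormalForm e ∧ ¬ e.IsValue ∧ ¬ e.IsStuck

def Diverges (e : Expr) : Prop := ∃ f : ℕ → Expr, f 0 = e ∧ ∀ n, Red (f n) (f (n + 1))

def DivOrErr (e : Expr) : Prop := Diverges e ∨ ∃ e', Reds e e' ∧ e'.IsError

/-! ### Contextual equivalence -/

/-- Equivalent observable actions. -/
def ObsEquiv (e₁ e₂ : Expr) : Prop :=
  ((∃ e', Reds e₁ e' ∧ e'.IsValue) ↔ (∃ e', Reds e₂ e' ∧ e'.IsValue)) ∧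
  ((∃ e', Reds e₁ e' ∧ e'.IsStuck) ↔ (∃ e', Reds e₂ e' ∧ e'.IsStuck)) ∧
  (DivOrErr e₁ ↔ DivOrErr e₂)

/-- Contextual equivalence of closed expressions, tested with the closed promptless evaluation
contexts. -/
def CtxEquiv (e₁ e₂ : Expr) : Prop :=
  e₁.fv = ∅ ∧ e₂.fv = ∅ ∧
    ∀ E : ECtx, E.fv = ∅ → E.prompts = ∅ → ObsEquiv (E.plug e₁) (E.plug e₂)

/-! ### Multi-hole contexts -/

mutual
/-- Multi-hole contexts. -/
inductive MCtx : Type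
  | val (C : MVCtx)
  | app (C₁ C₂ : MCtx)
  | gen (C : MCtx)
  | reset (Cv : MVCtx) (C : MCtx)
  | grab (Cv : MVCtx) (C : MCtx)
  | push (Cv : MVCtx) (C : MCtx)
  /-- `⋆ᵢ[C]`, where `⋆ᵢ` can be filled with continuations only -/
  | star (i : ℕ) (C : MCtx)
/-- Multi-hole value contexts. -/
inductive MVCtx : Type
  | var (n : ℕ)
  | lam (C : MCtx)
  | cont (C : MECtx)
  | hole (i : ℕ)
/-- Multi-hole evaluation contexts, with one special hole in evaluation position. -/
inductive MECtx : Type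
  | hole
  | appL (𝔼 : MECtx) (C : MCtx)
  | appR (Cv : MVCtx) (𝔼 : MECtx)
  | reset (i : ℕ) (𝔼 : MECtx)
  | star (i : ℕ) (𝔼 : MECtx)
end

mutual
/-- Free variables of a multi-hole context. -/
def MCtx.fv : MCtx → Set ℕ
  | .val C => C.fv
  | .app C₁ C₂ => C₁.fv ∪ C₂.fv
  | .gen C => {n | n + 1 ∈ C.fv}
  | .reset Cv C => Cv.fv ∪ C.fv
  | .grab Cv C => Cv.fv ∪ {n | n + 1 ∈ C.fv}
  | .push Cv C => Cv.fv ∪ C.fv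
  | .star _ C => C.fv
def MVCtx.fv : MVCtx → Set ℕ
  | .var n => {n}
  | .lam C => {n | n + 1 ∈ C.fv}
  | .cont C => C.fv
  | .hole _ => ∅
def MECtx.fv : MECtx → Set ℕ
  | .hole => ∅
  | .appL 𝔼 C => 𝔼.fv ∪ C.fv
  | .appR Cv 𝔼 => Cv.fv ∪ 𝔼.fv
  | .reset _ 𝔼 => 𝔼.fv
  | .star _ 𝔼 => 𝔼.fv
end

/-- The element of `Γ` at position `i`, if it exists and is a continuation. -/
def contAt (Γ : List Val) (i : ℕ) : Option ECtx :=
  match Γ[i]? with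
  | some (.cont E) => some E
  | _ => none

/-- The element of `Γ` at position `i`, if it exists and is a prompt. -/
def promptAt (Γ : List Val) (i : ℕ) : Option ℕ :=
  match Γ[i]? with
  | some (.prompt p) => some p
  | _ => none

/-- The sequence `Γ` under one more binder. -/
def shiftEnv (Γ : List Val) : List Val := Γ.map (Val.rename Nat.succ)

mutual
/-- `C[Γ]`; it is `none` when a hole has no suitable value in `Γ`. -/
def MCtx.fill : MCtx → List Val → Option Expr
  | .val C, Γ => do
      let v ← C.fill Γ
      return .val v
  | .app C₁ C₂, Γ => do
      let e₁ ← C₁.fill Γ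
      let e₂ ← C₂.fill Γ
      return .app e₁ e₂
  | .gen C, Γ => do
      let e ← C.fill (shiftEnv Γ)
      return .gen e
  | .reset Cv C, Γ => do
      let v ← Cv.fill Γ
      let e ← C.fill Γ
      return .reset v e
  | .grab Cv C, Γ => do
      let v ← Cv.fill Γ
      let e ← C.fill (shiftEnv Γ)
      return .grab v e
  | .push Cv C, Γ => do
      let v ← Cv.fill Γ
      let e ← C.fill Γ
      return .push v e
  | .star i C, Γ => do
      let E ← contAt Γ i
      let e ← C.fill Γ
      return E.plug e
def MVCtx.fill : MVCtx → List Val → Option Val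
  | .var n, _ => some (.var n)
  | .lam C, Γ => do
      let e ← C.fill (shiftEnv Γ)
      return .lam e
  | .cont C, Γ => do
      let E ← C.fill Γ
      return .cont E
  | .hole i, Γ => Γ[i]?
def MECtx.fill : MECtx → List Val → Option ECtx
  | .hole, _ => some .hole
  | .appL 𝔼 C, Γ => do
      let E ← 𝔼.fill Γ
      let e ← C.fill Γ
      return .appL E e
  | .appR Cv 𝔼, Γ => do
      let v ← Cv.fill Γ
      let E ← 𝔼.fill Γ
      return .appR v E
  | .reset i 𝔼, Γ => do
      let p ← promptAt Γ i
      let E ← 𝔼.fill Γ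
      return .reset p E
  | .star i 𝔼, Γ => do
      let F ← contAt Γ i
      let E ← 𝔼.fill Γ
      return F.comp E
end

/-! ### The labelled transition system -/

/-- States: `env Γ` is a finite sequence of values, `run Γ e` is the state `(Γ, e)` for an
expression `e` that is not a value. -/
inductive State : Type
  | env (Γ : List Val)
  | run (Γ : List Val) (e : Expr)

/-- The state `(Γ, e)` for an arbitrary expression `e`; when `e` is a value, it is the sequence
`Γ` extended with `e`. -/
def State.of (Γ : List Val) : Expr → State
  | .val v => .env (Γ ++ [v])
  | e => .run Γ e

/-- Proper states: all components are closed, and `e` is not a value in `run Γ e`. -/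
def State.Proper : State → Prop
  | .env Γ => ∀ v ∈ Γ, v.fv = ∅
  | .run Γ e => (∀ v ∈ Γ, v.fv = ∅) ∧ e.fv = ∅ ∧ ¬ e.IsValue

inductive Label : Type
  | tau
  | lam (i : ℕ) (Cv : MVCtx)
  | val
  | ctx (i : ℕ) (Cv : MVCtx)
  | decomp (i j : ℕ)
  | prompt (i j : ℕ)
  | newPrompt
  | stuck (𝔼 : MECtx)

/-- The passive labels; all others are active. -/
def Label.Passive : Label → Prop
  | .val => True
  | .ctx _ _ => True
  | _ => False

/-- A reduction step, or a stuttering step of a normal form. -/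
def RedBis (e e' : Expr) : Prop := Red e e' ∨ (NormalForm e ∧ e' = e)

/-- Transitions. Testing contexts are closed. -/
inductive Step : State → Label → State → Prop
  | tau (Γ : List Val) (e₁ e₂ : Expr) (h : Red e₁ e₂)
      (hfresh : (e₂.prompts \ e₁.prompts) ∩ envPrompts Γ = ∅) :
      Step (.run Γ e₁) .tau (.of Γ e₂)
  | lam (Γ : List Val) (i : ℕ) (e : Expr) (Cv : MVCtx) (v : Val) (hi : Γ[i]? = some (.lam e))
      (hC : Cv.fv = ∅) (hv : Cv.fill Γ = some v) :
      Step (.env Γ) (.lam i Cv) (.of Γ (e.inst v))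
  | val (Γ : List Val) : Step (.env Γ) .val (.env Γ)
  | ctx (Γ : List Val) (i : ℕ) (E : ECtx) (Cv : MVCtx) (v : Val) (hi : Γ[i]? = some (.cont E))
      (hC : Cv.fv = ∅) (hv : Cv.fill Γ = some v) :
      Step (.env Γ) (.ctx i Cv) (.of Γ (E.plug (.val v)))
  | decomp (Γ : List Val) (i j p : ℕ) (E₁ E₂ : ECtx)
      (hi : Γ[i]? = some (.cont (E₁.comp (.reset p E₂)))) (hj : Γ[j]? = some (.prompt p))
      (hp : p ∉ E₂.surPr) :
      Step (.env Γ) (.decomp i j) (.env (Γ ++ [.cont E₁, .cont E₂]))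
  | prompt (Γ : List Val) (i j p : ℕ) (hi : Γ[i]? = some (.prompt p))
      (hj : Γ[j]? = some (.prompt p)) : Step (.env Γ) (.prompt i j) (.env Γ)
  | newPrompt (Γ : List Val) (p : ℕ) (hp : p ∉ envPrompts Γ) :
      Step (.env Γ) .newPrompt (.env (Γ ++ [.prompt p]))
  | stuck (Γ : List Val) (E : ECtx) (p : ℕ) (e e' : Expr) (𝔼 : MECtx) (F : ECtx)
      (hp : p ∉ E.surPr) (hC : 𝔼.fv = ∅) (hF : 𝔼.fill Γ = some F)
      (h : RedBis (F.plug (E.plug (.grab (.prompt p) e))) e') :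
      Step (.run Γ (E.plug (.grab (.prompt p) e))) (.stuck 𝔼) (.of Γ e')

def WeakTau : State → State → Prop := Relation.ReflTransGen (fun s t => Step s .tau t)

/-- Weak transitions. -/
def WeakStep (s : State) (a : Label) (t : State) : Prop :=
  (a = .tau ∧ WeakTau s t) ∨
  (a ≠ .tau ∧ ∃ s' t', WeakTau s s' ∧ Step s' a t' ∧ WeakTau t' t)

/-! ### Star-bisimilarity -/

/-- `R` diacritically progresses to `S` (after passive transitions) and `T` (after active
transitions). -/
def DiacriticalProgress (R S T : State → State → Prop) : Prop :=
  (∀ s t, R s t → S s t) ∧ (∀ s t, R s t → T s t) ∧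
  ∀ s t, R s t →
    (∀ a s', a.Passive → Step s a s' → ∃ t', WeakStep t a t' ∧ S s' t') ∧
    (∀ a s', ¬ a.Passive → Step s a s' → ∃ t', WeakStep t a t' ∧ T s' t') ∧
    (∀ a t', a.Passive → Step t a t' → ∃ s', WeakStep s a s' ∧ S s' t') ∧
    (∀ a t', ¬ a.Passive → Step t a t' → ∃ s', WeakStep s a s' ∧ T s' t')

/-- Star-bisimulations: relations on proper states that progress to themselves. -/
def IsStarBisimulation (R : State → State → Prop) : Prop :=
  (∀ s t, R s t → s.Proper ∧ t.Proper) ∧ DiacriticalProgress R R R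

/-- Star-bisimilarity: the union of all star-bisimulations. -/
def StarBisim (s t : State) : Prop := ∃ R, IsStarBisimulation R ∧ R s t

/-- Star-bisimilarity of closed expressions, compared in the empty environment. -/
def StarBisimExpr (e₁ e₂ : Expr) : Prop := StarBisim (.of [] e₁) (.of [] e₂)

end PromptCalc

namespace PromptCalc

/-! ### Renaming and substitution -/

-- The proof exhibits one relation on terms and shows that it is both a bisimulation and
-- observationally sound. Let `ExprRel` be the compatible relation generated by (λx.E[x]) e ~
-- E'[e'], where E ~ E', e ~ e' and no prompt surrounds the hole of E. Values and evaluation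
-- contexts carry companion relations `ValRel` and `ECtxRel`. The relation is reflexive, stable
-- under substitution and plugging, and relates only terms with the same prompts. Freshness
-- conditions therefore transfer verbatim, and prompts never have to be renamed.
--
-- Evaluation of (λx.E[x]) e starts with e, and so does evaluation of E[e]. Until e is a value, both
-- sides step inside it. When e becomes a value v, the left side makes the one additional step
-- (λx.E[x]) v → E[v], after which the terms are related by compatibility. The delicate case is
-- capture: an operator inside e captures the frame (λx.E[x]) □ on the left and E on the right.
-- Since sp(E) = ∅, no delimiter of E can intercept the capture. Hence both sides find the same
-- delimiter, and the captured continuations are again related, by the clause `ECtxRel.eta`.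
--
-- The additional steps are called administrative (`AdmStep`). They preserve the set of prompts and
-- decrease the size, so only finitely many occur in a row. `FrameRed.sim_left` says that a left
-- step either keeps the relation while the term shrinks, or is matched by exactly one right step.
-- `FrameRed.sim_right` says that a right step is matched by administrative steps and one more step.
-- `ExprRel.adm_val` and `ExprRel.adm_plug_grab` say that the left term reaches, by administrative
-- steps, the value or the exposed capture operator that the right term already shows.
--
-- Contextual equivalence follows directly (`ExprRel.obsEquiv`), without passing through soundness
-- of bisimilarity. For bisimilarity the relation is lifted to states (`StateRel`); filling a
-- testing context with related sequences gives related terms, and the captures triggered by testing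
-- contexts match. Open terms need nothing new, because abstraction preserves `ExprRel`.

theorem upRen_comp (f g : ℕ → ℕ) : upRen f ∘ upRen g = upRen (f ∘ g) := by
  funext n; cases n <;> rfl

theorem upSubst_comp_upRen (s : ℕ → Val) (f : ℕ → ℕ) :
    upSubst s ∘ upRen f = upSubst (s ∘ f) := by
  funext n; cases n <;> rfl

mutual
theorem Expr.rename_rename (f g : ℕ → ℕ) : ∀ e : Expr, (e.rename f).rename g = e.rename (g ∘ f)
  | .val v => by simp only [Expr.rename, Val.rename_rename f g v]
  | .app a b => by simp only [Expr.rename, Expr.rename_rename f g a, Expr.rename_rename f g b]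
  | .gen e => by simp only [Expr.rename, Expr.rename_rename _ _ e, upRen_comp]
  | .reset v e => by simp only [Expr.rename, Val.rename_rename f g v, Expr.rename_rename f g e]
  | .grab v e => by
      simp only [Expr.rename, Val.rename_rename f g v, Expr.rename_rename _ _ e, upRen_comp]
  | .push v e => by simp only [Expr.rename, Val.rename_rename f g v, Expr.rename_rename f g e]
theorem Val.rename_rename (f g : ℕ → ℕ) : ∀ v : Val, (v.rename f).rename g = v.rename (g ∘ f)
  | .var n => rfl
  | .lam e => by simp only [Val.rename, Expr.rename_rename _ _ e, upRen_comp]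
  | .prompt p => rfl
  | .cont E => by simp only [Val.rename, ECtx.rename_rename f g E]
theorem ECtx.rename_rename (f g : ℕ → ℕ) : ∀ E : ECtx, (E.rename f).rename g = E.rename (g ∘ f)
  | .hole => rfl
  | .appL E e => by simp only [ECtx.rename, ECtx.rename_rename f g E, Expr.rename_rename f g e]
  | .appR v E => by simp only [ECtx.rename, ECtx.rename_rename f g E, Val.rename_rename f g v]
  | .reset p E => by simp only [ECtx.rename, ECtx.rename_rename f g E]
end

mutual
theorem Expr.rename_subst (f : ℕ → ℕ) (s : ℕ → Val) :
    ∀ e : Expr, (e.rename f).subst s = e.subst (s ∘ f)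
  | .val v => by simp only [Expr.rename, Expr.subst, Val.rename_subst f s v]
  | .app a b => by
      simp only [Expr.rename, Expr.subst, Expr.rename_subst f s a, Expr.rename_subst f s b]
  | .gen e => by
      simp only [Expr.rename, Expr.subst, Expr.rename_subst _ _ e, upSubst_comp_upRen]
  | .reset v e => by
      simp only [Expr.rename, Expr.subst, Val.rename_subst f s v, Expr.rename_subst f s e]
  | .grab v e => by
      simp only [Expr.rename, Expr.subst, Val.rename_subst f s v, Expr.rename_subst _ _ e,
        upSubst_comp_upRen]
  | .push v e => by
      simp only [Expr.rename, Expr.subst, Val.rename_subst f s v, Expr.rename_subst f s e]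
theorem Val.rename_subst (f : ℕ → ℕ) (s : ℕ → Val) :
    ∀ v : Val, (v.rename f).subst s = v.subst (s ∘ f)
  | .var n => rfl
  | .lam e => by
      simp only [Val.rename, Val.subst, Expr.rename_subst _ _ e, upSubst_comp_upRen]
  | .prompt p => rfl
  | .cont E => by simp only [Val.rename, Val.subst, ECtx.rename_subst f s E]
theorem ECtx.rename_subst (f : ℕ → ℕ) (s : ℕ → Val) :
    ∀ E : ECtx, (E.rename f).subst s = E.subst (s ∘ f)
  | .hole => rfl
  | .appL E e => by
      simp only [ECtx.rename, ECtx.subst, ECtx.rename_subst f s E, Expr.rename_subst f s e]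
  | .appR v E => by
      simp only [ECtx.rename, ECtx.subst, ECtx.rename_subst f s E, Val.rename_subst f s v]
  | .reset p E => by simp only [ECtx.rename, ECtx.subst, ECtx.rename_subst f s E]
end

theorem upSubst_rename (s : ℕ → Val) (f : ℕ → ℕ) :
    (fun n => (upSubst s n).rename (upRen f)) = upSubst (fun n => (s n).rename f) := by
  funext n
  cases n with
  | zero => rfl
  | succ n => simp only [upSubst, Val.rename_rename]; rfl

mutual
theorem Expr.subst_rename (s : ℕ → Val) (f : ℕ → ℕ) :
    ∀ e : Expr, (e.subst s).rename f = e.subst (fun n => (s n).rename f)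
  | .val v => by simp only [Expr.rename, Expr.subst, Val.subst_rename s f v]
  | .app a b => by
      simp only [Expr.rename, Expr.subst, Expr.subst_rename s f a, Expr.subst_rename s f b]
  | .gen e => by
      simp only [Expr.rename, Expr.subst, Expr.subst_rename _ _ e, upSubst_rename]
  | .reset v e => by
      simp only [Expr.rename, Expr.subst, Val.subst_rename s f v, Expr.subst_rename s f e]
  | .grab v e => by
      simp only [Expr.rename, Expr.subst, Val.subst_rename s f v, Expr.subst_rename _ _ e,
        upSubst_rename]
  | .push v e => by
      simp only [Expr.rename, Expr.subst, Val.subst_rename s f v, Expr.subst_rename s f e]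
theorem Val.subst_rename (s : ℕ → Val) (f : ℕ → ℕ) :
    ∀ v : Val, (v.subst s).rename f = v.subst (fun n => (s n).rename f)
  | .var n => rfl
  | .lam e => by simp only [Val.rename, Val.subst, Expr.subst_rename _ _ e, upSubst_rename]
  | .prompt p => rfl
  | .cont E => by simp only [Val.rename, Val.subst, ECtx.subst_rename s f E]
theorem ECtx.subst_rename (s : ℕ → Val) (f : ℕ → ℕ) :
    ∀ E : ECtx, (E.subst s).rename f = E.subst (fun n => (s n).rename f)
  | .hole => rfl
  | .appL E e => by
      simp only [ECtx.rename, ECtx.subst, ECtx.subst_rename s f E, Expr.subst_rename s f e]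
  | .appR v E => by
      simp only [ECtx.rename, ECtx.subst, ECtx.subst_rename s f E, Val.subst_rename s f v]
  | .reset p E => by simp only [ECtx.rename, ECtx.subst, ECtx.subst_rename s f E]
end

theorem upSubst_var : upSubst Val.var = Val.var := by
  funext n; cases n <;> rfl

mutual
theorem Expr.subst_var : ∀ e : Expr, e.subst Val.var = e
  | .val v => by simp only [Expr.subst, Val.subst_var v]
  | .app a b => by simp only [Expr.subst, Expr.subst_var a, Expr.subst_var b]
  | .gen e => by simp only [Expr.subst, upSubst_var, Expr.subst_var e]
  | .reset v e => by simp only [Expr.subst, Val.subst_var v, Expr.subst_var e]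
  | .grab v e => by simp only [Expr.subst, upSubst_var, Val.subst_var v, Expr.subst_var e]
  | .push v e => by simp only [Expr.subst, Val.subst_var v, Expr.subst_var e]
theorem Val.subst_var : ∀ v : Val, v.subst Val.var = v
  | .var n => rfl
  | .lam e => by simp only [Val.subst, upSubst_var, Expr.subst_var e]
  | .prompt p => rfl
  | .cont E => by simp only [Val.subst, ECtx.subst_var E]
theorem ECtx.subst_var : ∀ E : ECtx, E.subst Val.var = E
  | .hole => rfl
  | .appL E e => by simp only [ECtx.subst, ECtx.subst_var E, Expr.subst_var e]
  | .appR v E => by simp only [ECtx.subst, ECtx.subst_var E, Val.subst_var v]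
  | .reset p E => by simp only [ECtx.subst, ECtx.subst_var E]
end

theorem upRen_eq_of_eq {f g : ℕ → ℕ} {S : Set ℕ} (h : ∀ n, n + 1 ∈ S → f n = g n) :
    ∀ n ∈ S, upRen f n = upRen g n := by
  intro n hn
  cases n with
  | zero => rfl
  | succ n => simp only [upRen, h n hn]

mutual
theorem Expr.rename_congr {f g : ℕ → ℕ} :
    ∀ e : Expr, (∀ n ∈ e.fv, f n = g n) → e.rename f = e.rename g
  | .val v, h => by simp only [Expr.rename, Val.rename_congr v h]
  | .app a b, h => by
      simp only [Expr.rename, Expr.rename_congr a fun n hn => h n (.inl hn),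
        Expr.rename_congr b fun n hn => h n (.inr hn)]
  | .gen e, h => by simp only [Expr.rename, Expr.rename_congr e (upRen_eq_of_eq h)]
  | .reset v e, h => by
      simp only [Expr.rename, Val.rename_congr v fun n hn => h n (.inl hn),
        Expr.rename_congr e fun n hn => h n (.inr hn)]
  | .grab v e, h => by
      simp only [Expr.rename, Val.rename_congr v fun n hn => h n (.inl hn),
        Expr.rename_congr e (upRen_eq_of_eq fun n hn => h n (.inr hn))]
  | .push v e, h => by
      simp only [Expr.rename, Val.rename_congr v fun n hn => h n (.inl hn),
        Expr.rename_congr e fun n hn => h n (.inr hn)]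
theorem Val.rename_congr {f g : ℕ → ℕ} :
    ∀ v : Val, (∀ n ∈ v.fv, f n = g n) → v.rename f = v.rename g
  | .var n, h => by simp only [Val.rename, h n rfl]
  | .lam e, h => by simp only [Val.rename, Expr.rename_congr e (upRen_eq_of_eq h)]
  | .prompt p, _ => rfl
  | .cont E, h => by simp only [Val.rename, ECtx.rename_congr E h]
theorem ECtx.rename_congr {f g : ℕ → ℕ} :
    ∀ E : ECtx, (∀ n ∈ E.fv, f n = g n) → E.rename f = E.rename g
  | .hole, _ => rfl
  | .appL E e, h => by
      simp only [ECtx.rename, ECtx.rename_congr E fun n hn => h n (.inl hn),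
        Expr.rename_congr e fun n hn => h n (.inr hn)]
  | .appR v E, h => by
      simp only [ECtx.rename, Val.rename_congr v fun n hn => h n (.inl hn),
        ECtx.rename_congr E fun n hn => h n (.inr hn)]
  | .reset p E, h => by simp only [ECtx.rename, ECtx.rename_congr E h]
end

/-! ### Free variables -/

theorem fv_upRen {f : ℕ → ℕ} {S T : Set ℕ} (h : T ⊆ upRen f '' S) :
    {n | n + 1 ∈ T} ⊆ f '' {n | n + 1 ∈ S} := by
  intro n hn
  obtain ⟨m, hm, he⟩ := h hn
  cases m with
  | zero => cases he
  | succ m => exact ⟨m, hm, Nat.succ.inj he⟩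

mutual
theorem Expr.fv_rename (f : ℕ → ℕ) : ∀ e : Expr, (e.rename f).fv ⊆ f '' e.fv
  | .val v => Val.fv_rename f v
  | .app a b => by
      simp only [Expr.rename, Expr.fv, Set.image_union]
      exact Set.union_subset_union (Expr.fv_rename f a) (Expr.fv_rename f b)
  | .gen e => fv_upRen (Expr.fv_rename _ e)
  | .reset v e => by
      simp only [Expr.rename, Expr.fv, Set.image_union]
      exact Set.union_subset_union (Val.fv_rename f v) (Expr.fv_rename f e)
  | .grab v e => by
      simp only [Expr.rename, Expr.fv, Set.image_union]
      exact Set.union_subset_union (Val.fv_rename f v) (fv_upRen (Expr.fv_rename _ e))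
  | .push v e => by
      simp only [Expr.rename, Expr.fv, Set.image_union]
      exact Set.union_subset_union (Val.fv_rename f v) (Expr.fv_rename f e)
theorem Val.fv_rename (f : ℕ → ℕ) : ∀ v : Val, (v.rename f).fv ⊆ f '' v.fv
  | .var n => by simp [Val.rename, Val.fv]
  | .lam e => fv_upRen (Expr.fv_rename _ e)
  | .prompt p => by simp [Val.rename, Val.fv]
  | .cont E => ECtx.fv_rename f E
theorem ECtx.fv_rename (f : ℕ → ℕ) : ∀ E : ECtx, (E.rename f).fv ⊆ f '' E.fv
  | .hole => by simp [ECtx.rename, ECtx.fv]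
  | .appL E e => by
      simp only [ECtx.rename, ECtx.fv, Set.image_union]
      exact Set.union_subset_union (ECtx.fv_rename f E) (Expr.fv_rename f e)
  | .appR v E => by
      simp only [ECtx.rename, ECtx.fv, Set.image_union]
      exact Set.union_subset_union (Val.fv_rename f v) (ECtx.fv_rename f E)
  | .reset p E => ECtx.fv_rename f E
end

/-- The free variables of the values that `s` assigns to the members of `S`. -/
def substFv (s : ℕ → Val) (S : Set ℕ) : Set ℕ := {n | ∃ m ∈ S, n ∈ (s m).fv}

theorem substFv_union (s : ℕ → Val) (S T : Set ℕ) :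
    substFv s (S ∪ T) = substFv s S ∪ substFv s T := by
  ext n; simp only [substFv, Set.mem_union, Set.mem_ofPred_eq, or_and_right, exists_or]

theorem fv_upSubst {s : ℕ → Val} {S T : Set ℕ} (h : T ⊆ substFv (upSubst s) S) :
    {n | n + 1 ∈ T} ⊆ substFv s {n | n + 1 ∈ S} := by
  intro n hn
  obtain ⟨m, hm, he⟩ := h hn
  cases m with
  | zero => cases he
  | succ m =>
    obtain ⟨k, hk, hkn⟩ := Val.fv_rename _ _ he
    cases hkn
    exact ⟨m, hm, hk⟩

mutual
theorem Expr.fv_subst (s : ℕ → Val) : ∀ e : Expr, (e.subst s).fv ⊆ substFv s e.fv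
  | .val v => Val.fv_subst s v
  | .app a b => by
      simp only [Expr.subst, Expr.fv, substFv_union]
      exact Set.union_subset_union (Expr.fv_subst s a) (Expr.fv_subst s b)
  | .gen e => fv_upSubst (Expr.fv_subst _ e)
  | .reset v e => by
      simp only [Expr.subst, Expr.fv, substFv_union]
      exact Set.union_subset_union (Val.fv_subst s v) (Expr.fv_subst s e)
  | .grab v e => by
      simp only [Expr.subst, Expr.fv, substFv_union]
      exact Set.union_subset_union (Val.fv_subst s v) (fv_upSubst (Expr.fv_subst _ e))
  | .push v e => by
      simp only [Expr.subst, Expr.fv, substFv_union]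
      exact Set.union_subset_union (Val.fv_subst s v) (Expr.fv_subst s e)
theorem Val.fv_subst (s : ℕ → Val) : ∀ v : Val, (v.subst s).fv ⊆ substFv s v.fv
  | .var n => fun _ hm => ⟨n, rfl, hm⟩
  | .lam e => fv_upSubst (Expr.fv_subst _ e)
  | .prompt _ => Set.empty_subset _
  | .cont E => ECtx.fv_subst s E
theorem ECtx.fv_subst (s : ℕ → Val) : ∀ E : ECtx, (E.subst s).fv ⊆ substFv s E.fv
  | .hole => Set.empty_subset _
  | .appL E e => by
      simp only [ECtx.subst, ECtx.fv, substFv_union]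
      exact Set.union_subset_union (ECtx.fv_subst s E) (Expr.fv_subst s e)
  | .appR v E => by
      simp only [ECtx.subst, ECtx.fv, substFv_union]
      exact Set.union_subset_union (Val.fv_subst s v) (ECtx.fv_subst s E)
  | .reset p E => ECtx.fv_subst s E
end

theorem Expr.fv_inst (e : Expr) (v : Val) : (e.inst v).fv ⊆ {n | n + 1 ∈ e.fv} ∪ v.fv := by
  intro n hn
  obtain ⟨m, hm, h⟩ := Expr.fv_subst _ _ hn
  cases m with
  | zero => exact .inr h
  | succ m => cases h; exact .inl hm

theorem ECtx.fv_plug (e : Expr) : ∀ E : ECtx, (E.plug e).fv = E.fv ∪ e.fv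
  | .hole => by simp [ECtx.plug, ECtx.fv]
  | .appL E b => by
      simp only [ECtx.plug, ECtx.fv, Expr.fv, ECtx.fv_plug e E, Set.union_right_comm]
  | .appR v E => by simp only [ECtx.plug, ECtx.fv, Expr.fv, ECtx.fv_plug e E, Set.union_assoc]
  | .reset p E => by
      simp only [ECtx.plug, ECtx.fv, Expr.fv, Val.fv, ECtx.fv_plug e E, Set.empty_union]

theorem ECtx.fv_comp (F : ECtx) : ∀ E : ECtx, (E.comp F).fv = E.fv ∪ F.fv
  | .hole => by simp [ECtx.comp, ECtx.fv]
  | .appL E b => by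
      simp only [ECtx.comp, ECtx.fv, ECtx.fv_comp F E, Set.union_right_comm]
  | .appR v E => by simp only [ECtx.comp, ECtx.fv, ECtx.fv_comp F E, Set.union_assoc]
  | .reset p E => by simp only [ECtx.comp, ECtx.fv, ECtx.fv_comp F E]

theorem fv_lamVar (x : ℕ) (e : Expr) : (lamVar x e).fv ⊆ e.fv \ {x} := by
  intro n hn
  obtain ⟨m, hm, h⟩ := Expr.fv_rename _ _ hn
  dsimp only at h
  split at h
  -- The abstracted variable is sent to `0`, which is not a successor and so contributes no free
  -- variable under the binder.
  · cases h
  · rename_i hne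
    cases h
    exact ⟨hm, hne⟩

theorem fv_lamVars (e : Expr) : ∀ xs : List ℕ, (lamVars xs e).fv ⊆ e.fv \ {y | y ∈ xs}
  | [] => by simp [lamVars]
  | x :: xs => by
      intro n hn
      obtain ⟨h₁, h₂⟩ := fv_lamVar _ _ hn
      obtain ⟨h₃, h₄⟩ := fv_lamVars e xs h₁
      refine ⟨h₃, ?_⟩
      simp only [Set.mem_ofPred_eq, List.mem_cons, not_or]
      exact ⟨h₂, h₄⟩

/-! ### Plugging and composition -/

theorem ECtx.plug_rename (f : ℕ → ℕ) (e : Expr) :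
    ∀ E : ECtx, (E.plug e).rename f = (E.rename f).plug (e.rename f)
  | .hole => rfl
  | .appL E _ => by simp only [ECtx.plug, ECtx.rename, Expr.rename, ECtx.plug_rename f e E]
  | .appR _ E => by simp only [ECtx.plug, ECtx.rename, Expr.rename, ECtx.plug_rename f e E]
  | .reset _ E => by
      simp only [ECtx.plug, ECtx.rename, Expr.rename, Val.rename, ECtx.plug_rename f e E]

theorem ECtx.plug_subst (s : ℕ → Val) (e : Expr) :
    ∀ E : ECtx, (E.plug e).subst s = (E.subst s).plug (e.subst s)
  | .hole => rfl
  | .appL E _ => by simp only [ECtx.plug, ECtx.subst, Expr.subst, ECtx.plug_subst s e E]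
  | .appR _ E => by simp only [ECtx.plug, ECtx.subst, Expr.subst, ECtx.plug_subst s e E]
  | .reset _ E => by
      simp only [ECtx.plug, ECtx.subst, Expr.subst, Val.subst, ECtx.plug_subst s e E]

theorem ECtx.comp_rename (f : ℕ → ℕ) (F : ECtx) :
    ∀ E : ECtx, (E.comp F).rename f = (E.rename f).comp (F.rename f)
  | .hole => rfl
  | .appL E _ => by simp only [ECtx.comp, ECtx.rename, ECtx.comp_rename f F E]
  | .appR _ E => by simp only [ECtx.comp, ECtx.rename, ECtx.comp_rename f F E]
  | .reset _ E => by simp only [ECtx.comp, ECtx.rename, ECtx.comp_rename f F E]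

theorem ECtx.comp_subst (s : ℕ → Val) (F : ECtx) :
    ∀ E : ECtx, (E.comp F).subst s = (E.subst s).comp (F.subst s)
  | .hole => rfl
  | .appL E _ => by simp only [ECtx.comp, ECtx.subst, ECtx.comp_subst s F E]
  | .appR _ E => by simp only [ECtx.comp, ECtx.subst, ECtx.comp_subst s F E]
  | .reset _ E => by simp only [ECtx.comp, ECtx.subst, ECtx.comp_subst s F E]

theorem ECtx.plug_comp (F : ECtx) (e : Expr) :
    ∀ E : ECtx, (E.comp F).plug e = E.plug (F.plug e)
  | .hole => rfl
  | .appL E _ => by simp only [ECtx.plug, ECtx.comp, ECtx.plug_comp F e E]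
  | .appR _ E => by simp only [ECtx.plug, ECtx.comp, ECtx.plug_comp F e E]
  | .reset _ E => by simp only [ECtx.plug, ECtx.comp, ECtx.plug_comp F e E]

theorem ECtx.comp_assoc (F G : ECtx) : ∀ E : ECtx, (E.comp F).comp G = E.comp (F.comp G)
  | .hole => rfl
  | .appL E _ => by simp only [ECtx.comp, ECtx.comp_assoc F G E]
  | .appR _ E => by simp only [ECtx.comp, ECtx.comp_assoc F G E]
  | .reset _ E => by simp only [ECtx.comp, ECtx.comp_assoc F G E]

theorem ECtx.plug_eq_val {e : Expr} {v : Val} :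
    ∀ {E : ECtx}, E.plug e = .val v → E = .hole ∧ e = .val v
  | .hole, h => ⟨rfl, h⟩
  | .appL _ _, h => nomatch h
  | .appR _ _, h => nomatch h
  | .reset _ _, h => nomatch h

theorem ECtx.plug_eq_grab {e f : Expr} {v : Val} :
    ∀ {E : ECtx}, E.plug e = .grab v f → E = .hole ∧ e = .grab v f
  | .hole, h => ⟨rfl, h⟩
  | .appL _ _, h => nomatch h
  | .appR _ _, h => nomatch h
  | .reset _ _, h => nomatch h

/-- Unique decomposition: a context filled with a capture operator is never a value, so at each
application the two contexts must descend on the same side. -/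
theorem ECtx.plug_grab_inj {v v' : Val} {f f' : Expr} :
    ∀ {E E' : ECtx}, E.plug (.grab v f) = E'.plug (.grab v' f') → E = E' ∧ v = v' ∧ f = f'
  | .hole, E', h => by
      obtain ⟨rfl, h⟩ := ECtx.plug_eq_grab h.symm
      cases h
      exact ⟨rfl, rfl, rfl⟩
  | .appL E b, .hole, h => nomatch h
  | .appR w E, .hole, h => nomatch h
  | .reset p E, .hole, h => nomatch h
  | .appL E b, .appL E' b', h => by
      injection h with h₁ h₂
      obtain ⟨rfl, h₃⟩ := ECtx.plug_grab_inj h₁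
      exact ⟨by rw [h₂], h₃⟩
  | .appL E b, .appR w E', h => by
      injection h with h₁ h₂
      exact nomatch (ECtx.plug_eq_val h₁).2
  | .appR w E, .appL E' b, h => by
      injection h with h₁ h₂
      exact nomatch (ECtx.plug_eq_val h₁.symm).2
  | .appR w E, .appR w' E', h => by
      injection h with h₁ h₂
      obtain ⟨rfl, h₃⟩ := ECtx.plug_grab_inj h₂
      injection h₁ with h₁
      exact ⟨by rw [h₁], h₃⟩
  | .reset p E, .reset p' E', h => by
      injection h with h₁ h₂
      obtain ⟨rfl, h₃⟩ := ECtx.plug_grab_inj h₂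
      injection h₁ with h₁
      exact ⟨by rw [h₁], h₃⟩
  | .appL E b, .reset p E', h => nomatch h
  | .appR w E, .reset p E', h => nomatch h
  | .reset p E, .appL E' b, h => nomatch h
  | .reset p E, .appR w E', h => nomatch h

/-- A capture operator in evaluation position of `E[e]` is one of `e`. -/
theorem ECtx.plug_eq_plug_grab {e f : Expr} {v : Val} (he : ¬ e.IsValue) :
    ∀ {E F : ECtx}, E.plug e = F.plug (.grab v f) →
      ∃ G, F = E.comp G ∧ e = G.plug (.grab v f)
  | .hole, F, h => ⟨F, rfl, h⟩
  | .appL E b, .hole, h => nomatch h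
  | .appR w E, .hole, h => nomatch h
  | .reset p E, .hole, h => nomatch h
  | .appL E b, .appL F b', h => by
      injection h with h₁ h₂
      obtain ⟨G, rfl, h₃⟩ := ECtx.plug_eq_plug_grab he h₁
      exact ⟨G, by rw [h₂]; rfl, h₃⟩
  | .appL E b, .appR w F, h => by
      injection h with h₁ h₂
      exact absurd ⟨_, (ECtx.plug_eq_val h₁).2⟩ he
  | .appR w E, .appL F b, h => by
      injection h with h₁ h₂
      exact nomatch (ECtx.plug_eq_val h₁.symm).2
  | .appR w E, .appR w' F, h => by
      injection h with h₁ h₂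
      obtain ⟨G, rfl, h₃⟩ := ECtx.plug_eq_plug_grab he h₂
      injection h₁ with h₁
      exact ⟨G, by rw [h₁]; rfl, h₃⟩
  | .reset p E, .reset p' F, h => by
      injection h with h₁ h₂
      obtain ⟨G, rfl, h₃⟩ := ECtx.plug_eq_plug_grab he h₂
      injection h₁ with h₁
      exact ⟨G, by rw [h₁]; rfl, h₃⟩
  | .appL E b, .reset p F, h => nomatch h
  | .appR w E, .reset p F, h => nomatch h
  | .reset p E, .appL F b, h => nomatch h
  | .reset p E, .appR w F, h => nomatch h

/-! ### Surrounding prompts -/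

theorem ECtx.surPr_hole : ECtx.hole.surPr = ∅ := by
  ext p
  simp only [ECtx.surPr, Set.mem_ofPred_eq, Set.mem_empty_iff_false, iff_false]
  rintro ⟨E₁, E₂, h⟩
  cases E₁ <;> cases h

theorem ECtx.surPr_appL (E : ECtx) (e : Expr) : (ECtx.appL E e).surPr = E.surPr := by
  ext p
  constructor
  · rintro ⟨E₁, E₂, h⟩
    cases E₁ <;> cases h
    exact ⟨_, _, rfl⟩
  · rintro ⟨E₁, E₂, rfl⟩
    exact ⟨.appL E₁ e, E₂, rfl⟩

theorem ECtx.surPr_appR (v : Val) (E : ECtx) : (ECtx.appR v E).surPr = E.surPr := by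
  ext p
  constructor
  · rintro ⟨E₁, E₂, h⟩
    cases E₁ <;> cases h
    exact ⟨_, _, rfl⟩
  · rintro ⟨E₁, E₂, rfl⟩
    exact ⟨.appR v E₁, E₂, rfl⟩

theorem ECtx.surPr_reset (q : ℕ) (E : ECtx) : (ECtx.reset q E).surPr = {q} ∪ E.surPr := by
  ext p
  constructor
  · rintro ⟨E₁, E₂, h⟩
    cases E₁ <;> cases h
    · exact .inl rfl
    · exact .inr ⟨_, _, rfl⟩
  · rintro (rfl | ⟨E₁, E₂, rfl⟩)
    · exact ⟨.hole, E, rfl⟩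
    · exact ⟨.reset q E₁, E₂, rfl⟩

/-- This turns `surPr`, defined through decompositions, into a set computed frame by frame; a
context without delimiters contributes nothing to it. -/
theorem ECtx.surPr_comp (F : ECtx) : ∀ E : ECtx, (E.comp F).surPr = E.surPr ∪ F.surPr
  | .hole => by simp [ECtx.comp, ECtx.surPr_hole]
  | .appL E b => by simp only [ECtx.comp, ECtx.surPr_appL, ECtx.surPr_comp F E]
  | .appR v E => by simp only [ECtx.comp, ECtx.surPr_appR, ECtx.surPr_comp F E]
  | .reset p E => by
      simp only [ECtx.comp, ECtx.surPr_reset, ECtx.surPr_comp F E, Set.union_assoc]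

theorem ECtx.surPr_rename (f : ℕ → ℕ) : ∀ E : ECtx, (E.rename f).surPr = E.surPr
  | .hole => rfl
  | .appL E b => by simp only [ECtx.rename, ECtx.surPr_appL, ECtx.surPr_rename f E]
  | .appR v E => by simp only [ECtx.rename, ECtx.surPr_appR, ECtx.surPr_rename f E]
  | .reset p E => by simp only [ECtx.rename, ECtx.surPr_reset, ECtx.surPr_rename f E]

theorem ECtx.surPr_subst (s : ℕ → Val) : ∀ E : ECtx, (E.subst s).surPr = E.surPr
  | .hole => rfl
  | .appL E b => by simp only [ECtx.subst, ECtx.surPr_appL, ECtx.surPr_subst s E]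
  | .appR v E => by simp only [ECtx.subst, ECtx.surPr_appR, ECtx.surPr_subst s E]
  | .reset p E => by simp only [ECtx.subst, ECtx.surPr_reset, ECtx.surPr_subst s E]

/-- A delimiter of `E[F]` lies in `F` if `E` has none. -/
theorem ECtx.comp_eq_comp_reset {F F₂ : ECtx} {p : ℕ} :
    ∀ {E F₁ : ECtx}, E.surPr = ∅ → E.comp F = F₁.comp (.reset p F₂) →
      ∃ G, F = G.comp (.reset p F₂) ∧ F₁ = E.comp G
  | .hole, F₁, _, h => ⟨F₁, h, rfl⟩
  | .appL E b, .hole, _, h => nomatch h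
  | .appR v E, .hole, _, h => nomatch h
  | .appL E b, .appL F₁ b', hE, h => by
      injection h with h₁ h₂
      rw [ECtx.surPr_appL] at hE
      obtain ⟨G, h₃, rfl⟩ := ECtx.comp_eq_comp_reset hE h₁
      exact ⟨G, h₃, by rw [h₂]; rfl⟩
  | .appR v E, .appR v' F₁, hE, h => by
      injection h with h₁ h₂
      rw [ECtx.surPr_appR] at hE
      obtain ⟨G, h₃, rfl⟩ := ECtx.comp_eq_comp_reset hE h₂
      exact ⟨G, h₃, by rw [h₁]; rfl⟩
  | .reset q E, F₁, hE, h => by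
      rw [ECtx.surPr_reset] at hE
      exact absurd hE (Set.Nonempty.ne_empty ⟨q, .inl rfl⟩)
  | .appL E b, .appR v F₁, _, h => nomatch h
  | .appL E b, .reset q F₁, _, h => nomatch h
  | .appR v E, .appL F₁ b, _, h => nomatch h
  | .appR v E, .reset q F₁, _, h => nomatch h

/-! ### Prompts -/

mutual
theorem Expr.prompts_rename (f : ℕ → ℕ) : ∀ e : Expr, (e.rename f).prompts = e.prompts
  | .val v => by simp only [Expr.rename, Expr.prompts, Val.prompts_rename f v]
  | .app a b => by
      simp only [Expr.rename, Expr.prompts, Expr.prompts_rename f a, Expr.prompts_rename f b]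
  | .gen e => by simp only [Expr.rename, Expr.prompts, Expr.prompts_rename _ e]
  | .reset v e => by
      simp only [Expr.rename, Expr.prompts, Val.prompts_rename f v, Expr.prompts_rename f e]
  | .grab v e => by
      simp only [Expr.rename, Expr.prompts, Val.prompts_rename f v, Expr.prompts_rename _ e]
  | .push v e => by
      simp only [Expr.rename, Expr.prompts, Val.prompts_rename f v, Expr.prompts_rename f e]
theorem Val.prompts_rename (f : ℕ → ℕ) : ∀ v : Val, (v.rename f).prompts = v.prompts
  | .var n => rfl
  | .lam e => by simp only [Val.rename, Val.prompts, Expr.prompts_rename _ e]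
  | .prompt p => rfl
  | .cont E => by simp only [Val.rename, Val.prompts, ECtx.prompts_rename f E]
theorem ECtx.prompts_rename (f : ℕ → ℕ) : ∀ E : ECtx, (E.rename f).prompts = E.prompts
  | .hole => rfl
  | .appL E e => by
      simp only [ECtx.rename, ECtx.prompts, ECtx.prompts_rename f E, Expr.prompts_rename f e]
  | .appR v E => by
      simp only [ECtx.rename, ECtx.prompts, ECtx.prompts_rename f E, Val.prompts_rename f v]
  | .reset p E => by simp only [ECtx.rename, ECtx.prompts, ECtx.prompts_rename f E]
end

theorem ECtx.prompts_plug (e : Expr) : ∀ E : ECtx, (E.plug e).prompts = E.prompts ∪ e.prompts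
  | .hole => by simp [ECtx.plug, ECtx.prompts]
  | .appL E b => by
      simp only [ECtx.plug, ECtx.prompts, Expr.prompts, ECtx.prompts_plug e E,
        Set.union_right_comm]
  | .appR v E => by
      simp only [ECtx.plug, ECtx.prompts, Expr.prompts, ECtx.prompts_plug e E, Set.union_assoc]
  | .reset p E => by
      simp only [ECtx.plug, ECtx.prompts, Expr.prompts, Val.prompts, ECtx.prompts_plug e E,
        Set.union_assoc]

theorem ECtx.prompts_comp (F : ECtx) : ∀ E : ECtx, (E.comp F).prompts = E.prompts ∪ F.prompts
  | .hole => by simp [ECtx.comp, ECtx.prompts]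
  | .appL E b => by
      simp only [ECtx.comp, ECtx.prompts, ECtx.prompts_comp F E, Set.union_right_comm]
  | .appR v E => by simp only [ECtx.comp, ECtx.prompts, ECtx.prompts_comp F E, Set.union_assoc]
  | .reset p E => by
      simp only [ECtx.comp, ECtx.prompts, ECtx.prompts_comp F E, Set.union_assoc]

theorem prompts_upSubst {s : ℕ → Val} {S : Set ℕ} (h : ∀ n, (s n).prompts ⊆ S) (n : ℕ) :
    (upSubst s n).prompts ⊆ S := by
  cases n with
  | zero => exact Set.empty_subset _
  | succ n => simpa only [upSubst, Val.prompts_rename] using h n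

mutual
-- A fixed upper bound `S` passes unchanged under binders, where the substitution itself changes.
theorem Expr.prompts_subst {S : Set ℕ} (e : Expr) (s : ℕ → Val) (h : ∀ n, (s n).prompts ⊆ S)
    (he : e.prompts ⊆ S) : (e.subst s).prompts ⊆ S :=
  match e with
  | .val v => Val.prompts_subst v s h he
  | .app a b => Set.union_subset
      (Expr.prompts_subst a s h (Set.subset_union_left.trans he))
      (Expr.prompts_subst b s h (Set.subset_union_right.trans he))
  | .gen e => Expr.prompts_subst e _ (prompts_upSubst h) he
  | .reset v e => Set.union_subset
      (Val.prompts_subst v s h (Set.subset_union_left.trans he))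
      (Expr.prompts_subst e s h (Set.subset_union_right.trans he))
  | .grab v e => Set.union_subset
      (Val.prompts_subst v s h (Set.subset_union_left.trans he))
      (Expr.prompts_subst e _ (prompts_upSubst h) (Set.subset_union_right.trans he))
  | .push v e => Set.union_subset
      (Val.prompts_subst v s h (Set.subset_union_left.trans he))
      (Expr.prompts_subst e s h (Set.subset_union_right.trans he))
theorem Val.prompts_subst {S : Set ℕ} (v : Val) (s : ℕ → Val) (h : ∀ n, (s n).prompts ⊆ S)
    (he : v.prompts ⊆ S) : (v.subst s).prompts ⊆ S :=
  match v with
  | .var n => h n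
  | .lam e => Expr.prompts_subst e _ (prompts_upSubst h) he
  | .prompt _ => he
  | .cont E => ECtx.prompts_subst E s h he
theorem ECtx.prompts_subst {S : Set ℕ} (E : ECtx) (s : ℕ → Val) (h : ∀ n, (s n).prompts ⊆ S)
    (he : E.prompts ⊆ S) : (E.subst s).prompts ⊆ S :=
  match E with
  | .hole => Set.empty_subset _
  | .appL E e => Set.union_subset
      (ECtx.prompts_subst E s h (Set.subset_union_left.trans he))
      (Expr.prompts_subst e s h (Set.subset_union_right.trans he))
  | .appR v E => Set.union_subset
      (Val.prompts_subst v s h (Set.subset_union_left.trans he))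
      (ECtx.prompts_subst E s h (Set.subset_union_right.trans he))
  | .reset _ E => Set.union_subset
      (Set.subset_union_left.trans he)
      (ECtx.prompts_subst E s h (Set.subset_union_right.trans he))
end

theorem Expr.prompts_inst (e : Expr) (v : Val) :
    (e.inst v).prompts ⊆ e.prompts ∪ v.prompts := by
  refine Expr.prompts_subst e _ (fun n => ?_) Set.subset_union_left
  cases n with
  | zero => exact Set.subset_union_right
  | succ n => exact Set.empty_subset _

/-! ### Size -/

mutual
/-- The number of constructors of a term, the constructor `Expr.val` not being counted. -/
def Expr.size : Expr → ℕ
  | .val v => v.size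
  | .app a b => a.size + b.size + 1
  | .gen e => e.size + 1
  | .reset v e => v.size + e.size + 1
  | .grab v e => v.size + e.size + 1
  | .push v e => v.size + e.size + 1
def Val.size : Val → ℕ
  | .var _ => 1
  | .lam e => e.size + 1
  | .prompt _ => 1
  | .cont E => E.size + 1
def ECtx.size : ECtx → ℕ
  | .hole => 0
  | .appL E e => E.size + e.size + 1
  | .appR v E => v.size + E.size + 1
  | .reset _ E => 1 + E.size + 1
end

mutual
theorem Expr.size_rename (f : ℕ → ℕ) : ∀ e : Expr, (e.rename f).size = e.size
  | .val v => by simp only [Expr.rename, Expr.size, Val.size_rename f v]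
  | .app a b => by
      simp only [Expr.rename, Expr.size, Expr.size_rename f a, Expr.size_rename f b]
  | .gen e => by simp only [Expr.rename, Expr.size, Expr.size_rename _ e]
  | .reset v e => by
      simp only [Expr.rename, Expr.size, Val.size_rename f v, Expr.size_rename f e]
  | .grab v e => by
      simp only [Expr.rename, Expr.size, Val.size_rename f v, Expr.size_rename _ e]
  | .push v e => by
      simp only [Expr.rename, Expr.size, Val.size_rename f v, Expr.size_rename f e]
theorem Val.size_rename (f : ℕ → ℕ) : ∀ v : Val, (v.rename f).size = v.size
  | .var n => rfl
  | .lam e => by simp only [Val.rename, Val.size, Expr.size_rename _ e]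
  | .prompt p => rfl
  | .cont E => by simp only [Val.rename, Val.size, ECtx.size_rename f E]
theorem ECtx.size_rename (f : ℕ → ℕ) : ∀ E : ECtx, (E.rename f).size = E.size
  | .hole => rfl
  | .appL E e => by
      simp only [ECtx.rename, ECtx.size, ECtx.size_rename f E, Expr.size_rename f e]
  | .appR v E => by
      simp only [ECtx.rename, ECtx.size, ECtx.size_rename f E, Val.size_rename f v]
  | .reset p E => by simp only [ECtx.rename, ECtx.size, ECtx.size_rename f E]
end

theorem ECtx.size_plug (e : Expr) : ∀ E : ECtx, (E.plug e).size = E.size + e.size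
  | .hole => by simp [ECtx.plug, ECtx.size]
  | .appL E b => by simp only [ECtx.plug, ECtx.size, Expr.size, ECtx.size_plug e E]; omega
  | .appR v E => by simp only [ECtx.plug, ECtx.size, Expr.size, ECtx.size_plug e E]; omega
  | .reset p E => by
      simp only [ECtx.plug, ECtx.size, Expr.size, Val.size, ECtx.size_plug e E]; omega

/-! ### The congruence generated by the axiom -/

/-- The function `λx.E[x]`, for `x` not free in `E`. -/
def etaFun (E : ECtx) : Val := .lam ((E.rename Nat.succ).plug (.val (.var 0)))

mutual
/-- The smallest compatible relation that relates `(λx.E[x]) e` to `E[e]` if no prompt surrounds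
the hole of `E`. -/
inductive ExprRel : Expr → Expr → Prop
  | val {v v' : Val} (h : ValRel v v') : ExprRel (.val v) (.val v')
  | app {a a' b b' : Expr} (ha : ExprRel a a') (hb : ExprRel b b') :
      ExprRel (.app a b) (.app a' b')
  | gen {e e' : Expr} (h : ExprRel e e') : ExprRel (.gen e) (.gen e')
  | reset {v v' : Val} {e e' : Expr} (hv : ValRel v v') (h : ExprRel e e') :
      ExprRel (.reset v e) (.reset v' e')
  | grab {v v' : Val} {e e' : Expr} (hv : ValRel v v') (h : ExprRel e e') :
      ExprRel (.grab v e) (.grab v' e')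
  | push {v v' : Val} {e e' : Expr} (hv : ValRel v v') (h : ExprRel e e') :
      ExprRel (.push v e) (.push v' e')
  -- The contexts are related rather than equal: substituting related values into an instance
  -- changes its two sides differently.
  | eta {E E' : ECtx} {e e' : Expr} (hE : ECtxRel E E') (hs : E.surPr = ∅) (h : ExprRel e e') :
      ExprRel (.app (.val (etaFun E)) e) (E'.plug e')
inductive ValRel : Val → Val → Prop
  | var (n : ℕ) : ValRel (.var n) (.var n)
  | lam {e e' : Expr} (h : ExprRel e e') : ValRel (.lam e) (.lam e')
  | prompt (p : ℕ) : ValRel (.prompt p) (.prompt p)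
  | cont {E E' : ECtx} (h : ECtxRel E E') : ValRel (.cont E) (.cont E')
-- The clause `eta` covers evaluation contexts whose hole lies inside the argument of an instance of
-- the axiom. Such contexts arise when a capture cuts through an instance that is not yet
-- contracted.
inductive ECtxRel : ECtx → ECtx → Prop
  | hole : ECtxRel .hole .hole
  | appL {E E' : ECtx} {e e' : Expr} (hE : ECtxRel E E') (h : ExprRel e e') :
      ECtxRel (.appL E e) (.appL E' e')
  | appR {v v' : Val} {E E' : ECtx} (hv : ValRel v v') (hE : ECtxRel E E') :
      ECtxRel (.appR v E) (.appR v' E')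
  | reset (p : ℕ) {E E' : ECtx} (hE : ECtxRel E E') : ECtxRel (.reset p E) (.reset p E')
  | eta {E E' F F' : ECtx} (hE : ECtxRel E E') (hs : E.surPr = ∅) (hF : ECtxRel F F') :
      ECtxRel (.appR (etaFun E) F) (E'.comp F')
end

theorem etaFun_rename (f : ℕ → ℕ) (E : ECtx) : (etaFun E).rename f = etaFun (E.rename f) := by
  simp only [etaFun, Val.rename, ECtx.plug_rename, ECtx.rename_rename]
  rfl

theorem etaFun_subst (s : ℕ → Val) (E : ECtx) : (etaFun E).subst s = etaFun (E.subst s) := by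
  simp only [etaFun, Val.subst, ECtx.plug_subst, ECtx.rename_subst, ECtx.subst_rename]
  rfl

/-- Instantiation of index `0` undoes the shift of `E`. -/
theorem etaFun_body_inst (E : ECtx) (v : Val) :
    ((E.rename Nat.succ).plug (.val (.var 0))).inst v = E.plug (.val v) := by
  have h : single v ∘ Nat.succ = Val.var := rfl
  simp only [Expr.inst, ECtx.plug_subst, ECtx.rename_subst, h, ECtx.subst_var]
  rfl

theorem etaFun_prompts (E : ECtx) : (etaFun E).prompts = E.prompts := by
  simp only [etaFun, Val.prompts, ECtx.prompts_plug, ECtx.prompts_rename, Expr.prompts,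
    Set.union_empty]

theorem etaFun_size (E : ECtx) : (etaFun E).size = E.size + 2 := by
  simp only [etaFun, Val.size, ECtx.size_plug, ECtx.size_rename, Expr.size]

/-- Since `x` does not occur in `E`, the renaming that binds `x` acts on `E` as the plain shift;
this passes from the named formulation to `etaFun`. -/
theorem lamVar_plug_var {x : ℕ} {E : ECtx} (hx : x ∉ E.fv) :
    lamVar x (E.plug (.val (.var x))) = etaFun E := by
  simp only [lamVar, etaFun, ECtx.plug_rename, Expr.rename, Val.rename, if_true]
  rw [ECtx.rename_congr (g := Nat.succ)]
  intro n hn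
  exact if_neg (ne_of_mem_of_not_mem hn hx)

-- Closure of the congruence under renaming, substitution and plugging, and its invariants.

mutual
theorem ExprRel.refl : ∀ e : Expr, ExprRel e e
  | .val v => .val (ValRel.refl v)
  | .app a b => .app (ExprRel.refl a) (ExprRel.refl b)
  | .gen e => .gen (ExprRel.refl e)
  | .reset v e => .reset (ValRel.refl v) (ExprRel.refl e)
  | .grab v e => .grab (ValRel.refl v) (ExprRel.refl e)
  | .push v e => .push (ValRel.refl v) (ExprRel.refl e)
theorem ValRel.refl : ∀ v : Val, ValRel v v
  | .var n => .var n
  | .lam e => .lam (ExprRel.refl e)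
  | .prompt p => .prompt p
  | .cont E => .cont (ECtxRel.refl E)
theorem ECtxRel.refl : ∀ E : ECtx, ECtxRel E E
  | .hole => .hole
  | .appL E e => .appL (ECtxRel.refl E) (ExprRel.refl e)
  | .appR v E => .appR (ValRel.refl v) (ECtxRel.refl E)
  | .reset p E => .reset p (ECtxRel.refl E)
end

mutual
theorem ExprRel.rename {e e' : Expr} (f : ℕ → ℕ) :
    ExprRel e e' → ExprRel (e.rename f) (e'.rename f)
  | .val h => .val (h.rename f)
  | .app ha hb => .app (ha.rename f) (hb.rename f)
  | .gen h => .gen (h.rename _)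
  | .reset hv h => .reset (hv.rename f) (h.rename f)
  | .grab hv h => .grab (hv.rename f) (h.rename _)
  | .push hv h => .push (hv.rename f) (h.rename f)
  | .eta hE hs h => by
      simp only [Expr.rename, etaFun_rename, ECtx.plug_rename]
      exact .eta (hE.rename f) (by rw [ECtx.surPr_rename, hs]) (h.rename f)
theorem ValRel.rename {v v' : Val} (f : ℕ → ℕ) : ValRel v v' → ValRel (v.rename f) (v'.rename f)
  | .var n => .var _
  | .lam h => .lam (h.rename _)
  | .prompt p => .prompt p
  | .cont h => .cont (h.rename f)
theorem ECtxRel.rename {E E' : ECtx} (f : ℕ → ℕ) :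
    ECtxRel E E' → ECtxRel (E.rename f) (E'.rename f)
  | .hole => .hole
  | .appL hE h => .appL (hE.rename f) (h.rename f)
  | .appR hv hE => .appR (hv.rename f) (hE.rename f)
  | .reset p hE => .reset p (hE.rename f)
  | .eta hE hs hF => by
      simp only [ECtx.rename, etaFun_rename, ECtx.comp_rename]
      exact .eta (hE.rename f) (by rw [ECtx.surPr_rename, hs]) (hF.rename f)
end

theorem ValRel.upSubst {s s' : ℕ → Val} (h : ∀ n, ValRel (s n) (s' n)) (n : ℕ) :
    ValRel (upSubst s n) (PromptCalc.upSubst s' n) := by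
  cases n with
  | zero => exact .var 0
  | succ n => exact (h n).rename _

mutual
theorem ExprRel.subst {e e' : Expr} {s s' : ℕ → Val} (hs : ∀ n, ValRel (s n) (s' n)) :
    ExprRel e e' → ExprRel (e.subst s) (e'.subst s')
  | .val h => .val (h.subst hs)
  | .app ha hb => .app (ha.subst hs) (hb.subst hs)
  | .gen h => .gen (h.subst (ValRel.upSubst hs))
  | .reset hv h => .reset (hv.subst hs) (h.subst hs)
  | .grab hv h => .grab (hv.subst hs) (h.subst (ValRel.upSubst hs))
  | .push hv h => .push (hv.subst hs) (h.subst hs)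
  | .eta hE h₀ h => by
      simp only [Expr.subst, etaFun_subst, ECtx.plug_subst]
      exact .eta (hE.subst hs) (by rw [ECtx.surPr_subst, h₀]) (h.subst hs)
theorem ValRel.subst {v v' : Val} {s s' : ℕ → Val} (hs : ∀ n, ValRel (s n) (s' n)) :
    ValRel v v' → ValRel (v.subst s) (v'.subst s')
  | .var n => hs n
  | .lam h => .lam (h.subst (ValRel.upSubst hs))
  | .prompt p => .prompt p
  | .cont h => .cont (h.subst hs)
theorem ECtxRel.subst {E E' : ECtx} {s s' : ℕ → Val} (hs : ∀ n, ValRel (s n) (s' n)) :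
    ECtxRel E E' → ECtxRel (E.subst s) (E'.subst s')
  | .hole => .hole
  | .appL hE h => .appL (hE.subst hs) (h.subst hs)
  | .appR hv hE => .appR (hv.subst hs) (hE.subst hs)
  | .reset p hE => .reset p (hE.subst hs)
  | .eta hE h₀ hF => by
      simp only [ECtx.subst, etaFun_subst, ECtx.comp_subst]
      exact .eta (hE.subst hs) (by rw [ECtx.surPr_subst, h₀]) (hF.subst hs)
end

theorem ExprRel.inst {e e' : Expr} {v v' : Val} (h : ExprRel e e') (hv : ValRel v v') :
    ExprRel (e.inst v) (e'.inst v') := by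
  refine h.subst fun n => ?_
  cases n with
  | zero => exact hv
  | succ n => exact .var n

theorem ECtxRel.plug {E E' : ECtx} {e e' : Expr} (h : ExprRel e e') :
    ECtxRel E E' → ExprRel (E.plug e) (E'.plug e')
  | .hole => h
  | .appL hE hb => .app (hE.plug h) hb
  | .appR hv hE => .app (.val hv) (hE.plug h)
  | .reset p hE => .reset (.prompt p) (hE.plug h)
  | .eta hE hs hF => by
      rw [ECtx.plug_comp]
      exact .eta hE hs (hF.plug h)

theorem ECtxRel.comp {E E' F F' : ECtx} (hE : ECtxRel E E') (h : ECtxRel F F') :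
    ECtxRel (E.comp F) (E'.comp F') :=
  match hE with
  | .hole => h
  | .appL hE hb => .appL (hE.comp h) hb
  | .appR hv hE => .appR hv (hE.comp h)
  | .reset p hE => .reset p (hE.comp h)
  | .eta hE hs hF => by
      rw [ECtx.comp_assoc]
      exact .eta hE hs (hF.comp h)

mutual
-- Both sides of an instance contain the prompts of the context and of the argument. Thanks to
-- equality, rather than inclusion, the same fresh prompt can be chosen on the two sides.
theorem ExprRel.prompts_eq {e e' : Expr} : ExprRel e e' → e.prompts = e'.prompts
  | .val h => h.prompts_eq
  | .app ha hb => by simp only [Expr.prompts, ha.prompts_eq, hb.prompts_eq]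
  | .gen h => h.prompts_eq
  | .reset hv h => by simp only [Expr.prompts, hv.prompts_eq, h.prompts_eq]
  | .grab hv h => by simp only [Expr.prompts, hv.prompts_eq, h.prompts_eq]
  | .push hv h => by simp only [Expr.prompts, hv.prompts_eq, h.prompts_eq]
  | .eta hE hs h => by
      simp only [Expr.prompts, etaFun_prompts, ECtx.prompts_plug, hE.prompts_eq, h.prompts_eq]
theorem ValRel.prompts_eq {v v' : Val} : ValRel v v' → v.prompts = v'.prompts
  | .var n => rfl
  | .lam h => h.prompts_eq
  | .prompt p => rfl
  | .cont h => h.prompts_eq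
theorem ECtxRel.prompts_eq {E E' : ECtx} : ECtxRel E E' → E.prompts = E'.prompts
  | .hole => rfl
  | .appL hE h => by simp only [ECtx.prompts, hE.prompts_eq, h.prompts_eq]
  | .appR hv hE => by simp only [ECtx.prompts, hE.prompts_eq, hv.prompts_eq]
  | .reset p hE => by simp only [ECtx.prompts, hE.prompts_eq]
  | .eta hE hs hF => by
      simp only [ECtx.prompts, etaFun_prompts, ECtx.prompts_comp, hE.prompts_eq, hF.prompts_eq]
end

/-- The condition on the generating contexts is essential here: the delimiters of an instance's
context lie under the abstraction on the left but would surround the hole on the right. -/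
theorem ECtxRel.surPr_eq {E E' : ECtx} : ECtxRel E E' → E.surPr = E'.surPr
  | .hole => rfl
  | .appL hE _ => by simp only [ECtx.surPr_appL, hE.surPr_eq]
  | .appR _ hE => by simp only [ECtx.surPr_appR, hE.surPr_eq]
  | .reset p hE => by simp only [ECtx.surPr_reset, hE.surPr_eq]
  | .eta hE hs hF => by
      rw [ECtx.surPr_appR, ECtx.surPr_comp, hF.surPr_eq, ← hE.surPr_eq, hs, Set.empty_union]

/-! ### Decomposition of related terms -/

theorem ExprRel.val_left {v : Val} {e' : Expr} (h : ExprRel (.val v) e') :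
    ∃ v', e' = .val v' ∧ ValRel v v' := by
  cases h with
  | val h => exact ⟨_, rfl, h⟩

/-- No administrative step is needed in this direction: what is in evaluation position inside the
argument of an instance is still so after the argument is plugged into the context, and
`ECtxRel.eta` relates the two surroundings. -/
theorem ExprRel.plug_grab_left {v : Val} {f : Expr} : ∀ {E : ECtx} {e' : Expr},
    ExprRel (E.plug (.grab v f)) e' →
      ∃ E' v' f', e' = E'.plug (.grab v' f') ∧ ECtxRel E E' ∧ ValRel v v' ∧ ExprRel f f'
  | .hole, e', h => by
      cases h with
      | grab hv h => exact ⟨.hole, _, _, rfl, .hole, hv, h⟩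
  | .appL E b, e', h => by
      rw [ECtx.plug] at h
      generalize hg : E.plug (.grab v f) = g at h
      cases h with
      | app ha hb =>
        subst hg
        obtain ⟨E', v', f', rfl, h₁, h₂⟩ := ExprRel.plug_grab_left ha
        exact ⟨.appL E' _, v', f', rfl, .appL h₁ hb, h₂⟩
      | eta hE hs h => exact nomatch (ECtx.plug_eq_val hg).2
  | .appR w E, e', h => by
      rw [ECtx.plug] at h
      cases h with
      | app ha hb =>
        obtain ⟨w', rfl, hw⟩ := ha.val_left
        obtain ⟨E', v', f', rfl, h₁, h₂⟩ := ExprRel.plug_grab_left hb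
        exact ⟨.appR w' E', v', f', rfl, .appR hw h₁, h₂⟩
      | eta hE hs h =>
        obtain ⟨E', v', f', rfl, h₁, h₂⟩ := ExprRel.plug_grab_left h
        exact ⟨ECtx.comp _ E', v', f', (ECtx.plug_comp _ _ _).symm, .eta hE hs h₁, h₂⟩
  | .reset p E, e', h => by
      rw [ECtx.plug] at h
      cases h with
      | reset hw h =>
        cases hw
        obtain ⟨E', v', f', rfl, h₁, h₂⟩ := ExprRel.plug_grab_left h
        exact ⟨.reset p E', v', f', rfl, .reset p h₁, h₂⟩

theorem ECtxRel.comp_reset_left {p : ℕ} {E₂ : ECtx} : ∀ {E₁ E' : ECtx},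
    ECtxRel (E₁.comp (.reset p E₂)) E' →
      ∃ E₁' E₂', E' = E₁'.comp (.reset p E₂') ∧ ECtxRel E₁ E₁' ∧ ECtxRel E₂ E₂'
  | .hole, E', h => by
      cases h with
      | reset _ h => exact ⟨.hole, _, rfl, .hole, h⟩
  | .appL E b, E', h => by
      cases h with
      | appL hE hb =>
        obtain ⟨E₁', E₂', rfl, h₁, h₂⟩ := ECtxRel.comp_reset_left hE
        exact ⟨.appL E₁' _, E₂', rfl, .appL h₁ hb, h₂⟩
  | .appR v E, E', h => by
      cases h with
      | appR hv hE =>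
        obtain ⟨E₁', E₂', rfl, h₁, h₂⟩ := ECtxRel.comp_reset_left hE
        exact ⟨.appR _ E₁', E₂', rfl, .appR hv h₁, h₂⟩
      | eta hE hs hF =>
        obtain ⟨E₁', E₂', rfl, h₁, h₂⟩ := ECtxRel.comp_reset_left hF
        exact ⟨ECtx.comp _ E₁', E₂', (ECtx.comp_assoc _ _ _).symm, .eta hE hs h₁, h₂⟩
  | .reset q E, E', h => by
      cases h with
      | reset _ hE =>
        obtain ⟨E₁', E₂', rfl, h₁, h₂⟩ := ECtxRel.comp_reset_left hE
        exact ⟨.reset q E₁', E₂', rfl, .reset q h₁, h₂⟩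

/-- The recursion is on the derivation, since the right context of an instance does not show where
its first component ends. That component has no delimiter, so the chosen one lies in the second
component. -/
theorem ECtxRel.comp_reset_right {p : ℕ} {E₂' : ECtx} {E E' : ECtx} (h : ECtxRel E E')
    {E₁' : ECtx} (hE' : E' = E₁'.comp (.reset p E₂')) :
      ∃ E₁ E₂, E = E₁.comp (.reset p E₂) ∧ ECtxRel E₁ E₁' ∧ ECtxRel E₂ E₂' :=
  match h, E₁' with
  | .reset q h, .hole => by
      injection hE' with h₁ h₂
      subst h₁ h₂
      exact ⟨.hole, _, rfl, .hole, h⟩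
  | .reset q h, .reset r E₁' => by
      injection hE' with h₁ h₂
      subst h₁
      obtain ⟨E₁, E₂, rfl, h₁, h₂⟩ := h.comp_reset_right h₂
      exact ⟨.reset q E₁, E₂, rfl, .reset q h₁, h₂⟩
  | .appL h hb, .appL E₁' b => by
      injection hE' with h₁ h₂
      subst h₂
      obtain ⟨E₁, E₂, rfl, h₁, h₂⟩ := h.comp_reset_right h₁
      exact ⟨.appL E₁ _, E₂, rfl, .appL h₁ hb, h₂⟩
  | .appR hv h, .appR v E₁' => by
      injection hE' with h₁ h₂
      subst h₁
      obtain ⟨E₁, E₂, rfl, h₁, h₂⟩ := h.comp_reset_right h₂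
      exact ⟨.appR _ E₁, E₂, rfl, .appR hv h₁, h₂⟩
  | .eta hE hs hF, _ => by
      obtain ⟨G, h₁, rfl⟩ := ECtx.comp_eq_comp_reset (hE.surPr_eq ▸ hs) hE'
      obtain ⟨E₁, E₂, rfl, h₂, h₃⟩ := hF.comp_reset_right h₁
      exact ⟨.appR _ E₁, E₂, rfl, .eta hE hs h₂, h₃⟩
  | .hole, .hole => nomatch hE'
  | .appL _ _, .hole => nomatch hE'
  | .appR _ _, .hole => nomatch hE'
  | .appL _ _, .appR _ _ => nomatch hE'
  | .appL _ _, .reset _ _ => nomatch hE'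
  | .appR _ _, .appL _ _ => nomatch hE'
  | .appR _ _, .reset _ _ => nomatch hE'
  | .reset _ _, .appL _ _ => nomatch hE'
  | .reset _ _, .appR _ _ => nomatch hE'

/-! ### Structural presentation of reduction -/

/-- The prompts created by a step from `e` to `e'` do not occur in `S`. -/
def FreshFor (e e' : Expr) (S : Set ℕ) : Prop := (e'.prompts \ e.prompts) ∩ S = ∅

theorem FreshFor.mono {e e' f f' : Expr} {S T : Set ℕ} (h : FreshFor e e' S)
    (hef : f'.prompts \ f.prompts ⊆ e'.prompts \ e.prompts) (hST : T ⊆ S) : FreshFor f f' T :=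
  Set.subset_empty_iff.1 (h ▸ Set.inter_subset_inter hef hST)

theorem FreshFor.of_prompts_subset {e e' : Expr} (h : e'.prompts ⊆ e.prompts) (S : Set ℕ) :
    FreshFor e e' S := by
  simp only [FreshFor, Set.sdiff_eq_empty.2 h, Set.empty_inter]

theorem ECtx.prompts_plug_diff (E : ECtx) (e e' : Expr) :
    (E.plug e').prompts \ (E.plug e).prompts ⊆ e'.prompts \ e.prompts := by
  rw [ECtx.prompts_plug, ECtx.prompts_plug]
  rintro p ⟨h | h, h'⟩
  · exact absurd (.inl h) h'
  · exact ⟨h, fun h₁ => h' (.inr h₁)⟩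

/-- Reduction with one closure rule for each frame of an evaluation context. -/
inductive FrameRed : Expr → Expr → Prop
  | beta (e : Expr) (v : Val) : FrameRed (.app (.val (.lam e)) (.val v)) (e.inst v)
  | resetVal (p : ℕ) (v : Val) : FrameRed (.reset (.prompt p) (.val v)) (.val v)
  | capture (p : ℕ) (E : ECtx) (e : Expr) (hp : p ∉ E.surPr) :
      FrameRed (.reset (.prompt p) (E.plug (.grab (.prompt p) e))) (e.inst (.cont E))
  | throw (E : ECtx) (e : Expr) : FrameRed (.push (.cont E) e) (E.plug e)
  | gen (e : Expr) (p : ℕ) (hp : p ∉ e.prompts) : FrameRed (.gen e) (e.inst (.prompt p))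
  | appL {a a' : Expr} (b : Expr) (h : FrameRed a a') (hf : FreshFor a a' b.prompts) :
      FrameRed (.app a b) (.app a' b)
  | appR (v : Val) {b b' : Expr} (h : FrameRed b b') (hf : FreshFor b b' v.prompts) :
      FrameRed (.app (.val v) b) (.app (.val v) b')
  | reset (p : ℕ) {e e' : Expr} (h : FrameRed e e') (hf : FreshFor e e' {p}) :
      FrameRed (.reset (.prompt p) e) (.reset (.prompt p) e')

/-- Freshness for the whole context yields freshness for each frame, because plugging into a common
context adds no new prompt to a step. -/
theorem FrameRed.plug {e e' : Expr} (h : FrameRed e e') :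
    ∀ E : ECtx, FreshFor e e' E.prompts → FrameRed (E.plug e) (E.plug e')
  | .hole, _ => h
  | .appL E b, hf => .appL b (h.plug E (hf.mono subset_rfl Set.subset_union_left))
      (hf.mono (E.prompts_plug_diff e e') Set.subset_union_right)
  | .appR v E, hf => .appR v (h.plug E (hf.mono subset_rfl Set.subset_union_right))
      (hf.mono (E.prompts_plug_diff e e') Set.subset_union_left)
  | .reset p E, hf => .reset p (h.plug E (hf.mono subset_rfl Set.subset_union_right))
      (hf.mono (E.prompts_plug_diff e e') Set.subset_union_left)

theorem red_iff_frameRed {e e' : Expr} : Red e e' ↔ FrameRed e e' := by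
  constructor
  · intro h
    induction h with
    | beta e v => exact .beta e v
    | resetVal p v => exact .resetVal p v
    | capture p E e hp => exact .capture p E e hp
    | throw E e => exact .throw E e
    | gen e p hp => exact .gen e p hp
    | compat E e₁ e₂ _ hf ih => exact ih.plug E hf
  · intro h
    induction h with
    | beta e v => exact .beta e v
    | resetVal p v => exact .resetVal p v
    | capture p E e hp => exact .capture p E e hp
    | throw E e => exact .throw E e
    | gen e p hp => exact .gen e p hp
    | appL b _ hf ih =>
      exact .compat (.appL .hole b) _ _ ih
          (hf.mono subset_rfl (by simp [ECtx.prompts]))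
    | appR v _ hf ih =>
      exact .compat (.appR v .hole) _ _ ih
          (hf.mono subset_rfl (by simp [ECtx.prompts]))
    | reset p _ hf ih =>
      exact .compat (.reset p .hole) _ _ ih
          (hf.mono subset_rfl (by simp [ECtx.prompts]))

theorem not_frameRed_val {v : Val} {e : Expr} : ¬ FrameRed (.val v) e := nofun

/-- A step of `E[e]`, where no prompt surrounds the hole of `E` and `e` is no value, is one of
`e`. -/
theorem FrameRed.of_plug {e c : Expr} (he : ¬ e.IsValue) : ∀ {E : ECtx}, E.surPr = ∅ →
    FrameRed (E.plug e) c → ∃ e', c = E.plug e' ∧ FrameRed e e' ∧ FreshFor e e' E.prompts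
  | .hole, _, h => ⟨c, rfl, h, Set.inter_empty _⟩
  | .appL E b, hE, h => by
      rw [ECtx.surPr_appL] at hE
      rw [ECtx.plug] at h
      generalize hg : E.plug e = g at h
      cases h with
      | beta f v => exact absurd ⟨_, (ECtx.plug_eq_val hg).2⟩ he
      | appR v h hf => exact absurd ⟨_, (ECtx.plug_eq_val hg).2⟩ he
      | appL _ h hf =>
        subst hg
        obtain ⟨e', rfl, h₁, h₂⟩ := FrameRed.of_plug he hE h
        refine ⟨e', rfl, h₁, ?_⟩
        simp only [FreshFor, ECtx.prompts, ECtx.prompts_plug] at hf h₂ ⊢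
        rw [Set.eq_empty_iff_forall_notMem] at hf h₂ ⊢
        rintro p ⟨⟨hp, hp'⟩, hE | hb⟩
        · exact h₂ p ⟨⟨hp, hp'⟩, hE⟩
        -- A prompt created by the inner step is absent from `E`, hence also new for the plugged
        -- terms, so the outer freshness condition applies to it.
        · have hpE : p ∉ E.prompts := fun hE => h₂ p ⟨⟨hp, hp'⟩, hE⟩
          exact hf p ⟨⟨.inr hp, fun h => h.elim hpE hp'⟩, hb⟩
  | .appR v E, hE, h => by
      rw [ECtx.surPr_appR] at hE
      rw [ECtx.plug] at h
      generalize hg : E.plug e = g at h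
      cases h with
      | beta f v => exact absurd ⟨_, (ECtx.plug_eq_val hg).2⟩ he
      | appL _ h hf => exact absurd h not_frameRed_val
      | appR v h hf =>
        subst hg
        obtain ⟨e', rfl, h₁, h₂⟩ := FrameRed.of_plug he hE h
        refine ⟨e', rfl, h₁, ?_⟩
        simp only [FreshFor, ECtx.prompts, ECtx.prompts_plug] at hf h₂ ⊢
        rw [Set.eq_empty_iff_forall_notMem] at hf h₂ ⊢
        rintro p ⟨⟨hp, hp'⟩, hv | hE⟩
        · have hpE : p ∉ E.prompts := fun hE => h₂ p ⟨⟨hp, hp'⟩, hE⟩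
          exact hf p ⟨⟨.inr hp, fun h => h.elim hpE hp'⟩, hv⟩
        · exact h₂ p ⟨⟨hp, hp'⟩, hE⟩
  | .reset p E, hE, _ => by
      rw [ECtx.surPr_reset] at hE
      exact absurd hE (Set.Nonempty.ne_empty ⟨p, .inl rfl⟩)

/-- A step of a capture operator in an evaluation context is the capture. -/
theorem FrameRed.plug_grab {p : ℕ} {f c : Expr} : ∀ {E : ECtx},
    FrameRed (E.plug (.grab (.prompt p) f)) c → ∃ E₁ E₂ : ECtx, E = E₁.comp (.reset p E₂) ∧
      p ∉ E₂.surPr ∧ c = E₁.plug (f.inst (.cont E₂))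
  | .hole, h => nomatch h
  | .appL E b, h => by
      rw [ECtx.plug] at h
      generalize hg : E.plug (.grab (.prompt p) f) = g at h
      cases h with
      | beta f v => exact nomatch (ECtx.plug_eq_val hg).2
      | appR v h hf => exact nomatch (ECtx.plug_eq_val hg).2
      | appL _ h hf =>
        subst hg
        obtain ⟨E₁, E₂, rfl, h₁, rfl⟩ := h.plug_grab
        exact ⟨.appL E₁ b, E₂, rfl, h₁, rfl⟩
  | .appR v E, h => by
      rw [ECtx.plug] at h
      generalize hg : E.plug (.grab (.prompt p) f) = g at h
      cases h with
      | beta f v => exact nomatch (ECtx.plug_eq_val hg).2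
      | appL _ h hf => exact absurd h not_frameRed_val
      | appR v h hf =>
        subst hg
        obtain ⟨E₁, E₂, rfl, h₁, rfl⟩ := h.plug_grab
        exact ⟨.appR v E₁, E₂, rfl, h₁, rfl⟩
  | .reset q E, h => by
      rw [ECtx.plug] at h
      generalize hg : E.plug (.grab (.prompt p) f) = g at h
      cases h with
      | resetVal _ v => exact nomatch (ECtx.plug_eq_val hg).2
      | capture _ F f' hp =>
        obtain ⟨rfl, h₁, rfl⟩ := ECtx.plug_grab_inj hg
        cases h₁
        exact ⟨.hole, E, rfl, hp, rfl⟩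
      | reset _ h hf =>
        subst hg
        obtain ⟨E₁, E₂, rfl, h₁, rfl⟩ := h.plug_grab
        exact ⟨.reset q E₁, E₂, rfl, h₁, rfl⟩

/-- A capture creates no prompt, so it is compatible with every surrounding context. -/
theorem FrameRed.capture_plug {p : ℕ} (E₁ E₂ : ECtx) (f : Expr) (hp : p ∉ E₂.surPr) :
    FrameRed ((E₁.comp (.reset p E₂)).plug (.grab (.prompt p) f))
      (E₁.plug (f.inst (.cont E₂))) := by
  rw [ECtx.plug_comp]
  refine (FrameRed.capture p E₂ f hp).plug E₁ (.of_prompts_subset ?_ _)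
  refine (Expr.prompts_inst _ _).trans ?_
  simp only [Expr.prompts, Val.prompts, ECtx.prompts_plug]
  intro q
  simp only [Set.mem_union]
  tauto

theorem FrameRed.fv_subset {e e' : Expr} (h : FrameRed e e') : e'.fv ⊆ e.fv := by
  induction h with
  | beta e v => exact Expr.fv_inst _ _
  | resetVal p v => exact Set.subset_union_right
  | capture p E e hp =>
    refine (Expr.fv_inst _ _).trans ?_
    intro q
    simp only [Expr.fv, Val.fv, ECtx.fv_plug, Set.mem_union, Set.mem_ofPred_eq]
    tauto
  | throw E e => rw [ECtx.fv_plug]; exact subset_rfl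
  | gen e p hp => exact (Expr.fv_inst e (.prompt p)).trans (Set.union_empty _).subset
  | appL b _ hf ih => exact Set.union_subset_union_left _ ih
  | appR v _ hf ih => exact Set.union_subset_union_right _ ih
  | reset p _ hf ih => exact Set.union_subset_union_right _ ih

/-! ### Administrative reduction -/

/-- A step that creates no prompt, erases none, and makes the term smaller. -/
def AdmStep (e e' : Expr) : Prop :=
  FrameRed e e' ∧ e'.prompts = e.prompts ∧ e'.size < e.size

def Adm : Expr → Expr → Prop := Relation.ReflTransGen AdmStep

theorem Adm.trans {a b c : Expr} (h : Adm a b) (h' : Adm b c) : Adm a c :=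
  Relation.ReflTransGen.trans h h'

theorem Adm.plug (E : ECtx) {e e' : Expr} (h : Adm e e') : Adm (E.plug e) (E.plug e') := by
  refine Relation.ReflTransGen.lift E.plug (fun a b h => ?_) _ _ h
  refine ⟨?_, ?_, ?_⟩
  · exact h.1.plug E (.of_prompts_subset h.2.1.subset _)
  · rw [ECtx.prompts_plug, ECtx.prompts_plug, h.2.1]
  · have := h.2.2
    rw [ECtx.size_plug, ECtx.size_plug]
    omega

theorem Adm.prompts_eq {e e' : Expr} (h : Adm e e') : e'.prompts = e.prompts := by
  induction h with
  | refl => rfl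
  | tail _ h ih => rw [h.2.1, ih]

theorem Adm.size_le {e e' : Expr} (h : Adm e e') : e'.size ≤ e.size := by
  induction h with
  | refl => exact le_rfl
  | tail _ h ih => exact h.2.2.le.trans ih

theorem admStep_eta (E : ECtx) (v : Val) :
    AdmStep (.app (.val (etaFun E)) (.val v)) (E.plug (.val v)) := by
  refine ⟨?_, ?_, ?_⟩
  · rw [← etaFun_body_inst E v]
    exact .beta _ v
  · simp only [ECtx.prompts_plug, Expr.prompts, etaFun_prompts]
  · simp only [ECtx.size_plug, Expr.size, etaFun_size]
    omega

/-- Contraction of an instance: the argument is evaluated first, then one beta step is made. -/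
theorem Adm.eta (E : ECtx) {e : Expr} {v : Val} (h : Adm e (.val v)) :
    Adm (.app (.val (etaFun E)) e) (E.plug (.val v)) :=
  (h.plug (.appR (etaFun E) .hole)).tail (admStep_eta E v)

theorem Adm.eta_size_lt (E : ECtx) {e : Expr} {v : Val} (h : Adm e (.val v)) :
    (E.plug (.val v)).size < (Expr.app (.val (etaFun E)) e).size := by
  have := h.size_le
  simp only [ECtx.size_plug, Expr.size, etaFun_size] at this ⊢
  omega

/-- If an instance corresponds to a value, its right context is the hole and its argument
corresponds to that value. After contraction one continues with `E.plug (.val w)`, which is no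
subterm of `e` but is smaller; hence the induction on size. -/
theorem ExprRel.adm_val {v' : Val} : ∀ {e : Expr}, ExprRel e (.val v') →
    ∃ v, Adm e (.val v) ∧ ValRel v v' := by
  suffices H : ∀ n, ∀ e : Expr, e.size < n → ∀ e', ExprRel e e' → e' = .val v' →
      ∃ v, Adm e (.val v) ∧ ValRel v v' from fun {_} h => H _ _ (Nat.lt_succ_self _) _ h rfl
  intro n
  induction n with
  | zero => exact fun e h => absurd h (Nat.not_lt_zero _)
  | succ n ih =>
    intro e hn e' h he
    cases h with
    | val h => cases he; exact ⟨_, .refl, h⟩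
    | @eta E E' e e' hE hs h =>
      obtain ⟨rfl, rfl⟩ := ECtx.plug_eq_val he
      obtain ⟨w, hw, hwv⟩ := ih e (by simp only [Expr.size] at hn; omega) _ h rfl
      have hlt := hw.eta_size_lt E
      obtain ⟨v, hv, hvv⟩ := ih _ (by omega) _ (hE.plug (.val hwv)) rfl
      exact ⟨v, (hw.eta E).trans hv, hvv⟩
    | _ => cases he

theorem ExprRel.adm_plug_grab {v' : Val} {f' : Expr} : ∀ {e : Expr} {E' : ECtx},
    ExprRel e (E'.plug (.grab v' f')) →
      ∃ E v f, Adm e (E.plug (.grab v f)) ∧ ECtxRel E E' ∧ ValRel v v' ∧ ExprRel f f' := by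
  suffices H : ∀ n, ∀ e : Expr, e.size < n → ∀ e' E', ExprRel e e' →
      e' = E'.plug (.grab v' f') → ∃ E v f, Adm e (E.plug (.grab v f)) ∧ ECtxRel E E' ∧
        ValRel v v' ∧ ExprRel f f' from fun {_ _} h => H _ _ (Nat.lt_succ_self _) _ _ h rfl
  intro n
  induction n with
  | zero => exact fun e h => absurd h (Nat.not_lt_zero _)
  | succ n ih =>
    intro e hn e' E' h he
    cases h with
    | val h => exact nomatch (ECtx.plug_eq_val he.symm).2
    | @app a a' b b' ha hb =>
      simp only [Expr.size] at hn
      cases E' with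
      | hole => cases he
      | reset => cases he
      | appL E' c =>
        injection he with h₁ h₂
        subst h₂
        obtain ⟨E, v, f, h₁, h₂, h₃⟩ := ih a (by omega) _ _ ha h₁
        exact ⟨.appL E b, v, f, h₁.plug (.appL .hole b), .appL h₂ hb, h₃⟩
      | appR w' E' =>
        injection he with h₁ h₂
        subst h₁
        -- The function is a value on the right but possibly not on the left; it must be evaluated
        -- before the argument comes into evaluation position.
        obtain ⟨w, hw, hww⟩ := ha.adm_val
        obtain ⟨E, v, f, h₁, h₂, h₃⟩ := ih b (by omega) _ _ hb h₂
        exact ⟨.appR w E, v, f, (hw.plug (.appL .hole b)).trans (h₁.plug (.appR w .hole)),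
          .appR hww h₂, h₃⟩
    | gen h => cases E' <;> cases he
    | @reset w w' e e' hw h =>
      simp only [Expr.size] at hn
      cases E' with
      | hole => cases he
      | appL => cases he
      | appR => cases he
      | reset p E' =>
        injection he with h₁ h₂
        subst h₁
        cases hw
        obtain ⟨E, v, f, h₁, h₂, h₃⟩ := ih e (by omega) _ _ h h₂
        exact ⟨.reset p E, v, f, h₁.plug (.reset p .hole), .reset p h₂, h₃⟩
    | grab hv h =>
      obtain ⟨rfl, he⟩ := ECtx.plug_eq_grab he.symm
      cases he
      exact ⟨.hole, _, _, .refl, .hole, hv, h⟩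
    | push hv h => cases E' <;> cases he
    | @eta F F' e e' hF hs h =>
      -- If the argument is a value on the right, the operator comes from `F'` and the left instance
      -- must be contracted. Otherwise the operator lies in the argument, and the uncontracted
      -- instance becomes part of the context.
      by_cases hv : e'.IsValue
      · obtain ⟨w', rfl⟩ := hv
        obtain ⟨w, hw, hww⟩ := h.adm_val
        have hlt := hw.eta_size_lt F
        obtain ⟨E, v, f, h₁, h₂⟩ := ih _ (by omega) _ _ (hF.plug (.val hww)) he
        exact ⟨E, v, f, (hw.eta F).trans h₁, h₂⟩
      · obtain ⟨G, rfl, h₁⟩ := ECtx.plug_eq_plug_grab hv he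
        obtain ⟨E, v, f, h₁, h₂, h₃⟩ := ih e (by simp only [Expr.size] at hn; omega) _ _ h h₁
        exact ⟨.appR (etaFun F) E, v, f, h₁.plug (.appR (etaFun F) .hole), .eta hF hs h₂, h₃⟩

/-! ### Simulation -/

theorem FreshFor.congr {e e₁ e' e₁' : Expr} {S S' : Set ℕ} (h : FreshFor e e₁ S)
    (he : ExprRel e e') (he₁ : ExprRel e₁ e₁') (hS : S = S') : FreshFor e' e₁' S' := by
  rwa [FreshFor, ← he.prompts_eq, ← he₁.prompts_eq, ← hS]

theorem FreshFor.congr_symm {e e₁ e' e₁' : Expr} {S S' : Set ℕ} (h : FreshFor e' e₁' S')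
    (he : ExprRel e e') (he₁ : ExprRel e₁ e₁') (hS : S = S') : FreshFor e e₁ S := by
  rwa [FreshFor, he.prompts_eq, he₁.prompts_eq, hS]

/-- A step on the left is either administrative or matched by exactly one step on the right. -/
theorem FrameRed.sim_left {e e₁ : Expr} (hr : FrameRed e e₁) : ∀ {e' : Expr}, ExprRel e e' →
    (ExprRel e₁ e' ∧ e₁.size < e.size) ∨ ∃ e₁', FrameRed e' e₁' ∧ ExprRel e₁ e₁' := by
  induction hr with
  | beta f v =>
    intro e' h
    generalize hg : Val.lam f = g at h
    cases h with
    | app ha hb =>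
      subst hg
      obtain ⟨_, rfl, hf⟩ := ha.val_left
      obtain ⟨v', rfl, hv⟩ := hb.val_left
      cases hf with
      | lam hf => exact .inr ⟨_, .beta _ _, hf.inst hv⟩
    | @eta E E' _ e' hE hs h =>
      cases hg
      -- An instance is contracted at a value: the left term becomes the context filled with that
      -- value, already related to the unmoved right term.
      refine .inl ⟨?_, ?_⟩
      · rw [etaFun_body_inst]; exact hE.plug h
      · rw [etaFun_body_inst]; exact (admStep_eta E v).2.2
  | resetVal p v =>
    intro e' h
    cases h with
    | reset hp h =>
      cases hp
      obtain ⟨v', rfl, hv⟩ := h.val_left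
      exact .inr ⟨_, .resetVal _ _, .val hv⟩
  | capture p E f hp =>
    intro e' h
    cases h with
    | reset hq h =>
      cases hq
      obtain ⟨E', _, f', rfl, hE, hq, hf⟩ := h.plug_grab_left
      cases hq
      exact .inr ⟨_, .capture p E' f' (hE.surPr_eq ▸ hp), hf.inst (.cont hE)⟩
  | throw E f =>
    intro e' h
    cases h with
    | push hE h =>
      cases hE with
      | cont hE => exact .inr ⟨_, .throw _ _, hE.plug h⟩
  | gen f p hp =>
    intro e' h
    cases h with
    | gen h => exact .inr ⟨_, .gen _ p (h.prompts_eq ▸ hp), h.inst (.prompt p)⟩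
  | appL b hr hf ih =>
    intro e' h
    cases h with
    | app ha hb =>
      rcases ih ha with ⟨h₁, h₂⟩ | ⟨a₁', h₁, h₂⟩
      · exact .inl ⟨.app h₁ hb, by simp only [Expr.size]; omega⟩
      · exact .inr ⟨_, .appL _ h₁ (hf.congr ha h₂ hb.prompts_eq), .app h₂ hb⟩
    | eta => exact absurd hr not_frameRed_val
  | appR v hr hf ih =>
    intro e' h
    cases h with
    | app ha hb =>
      obtain ⟨v', rfl, hv⟩ := ha.val_left
      rcases ih hb with ⟨h₁, h₂⟩ | ⟨a₁', h₁, h₂⟩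
      · exact .inl ⟨.app ha h₁, by simp only [Expr.size]; omega⟩
      · exact .inr ⟨_, .appR _ h₁ (hf.congr hb h₂ hv.prompts_eq), .app ha h₂⟩
    | eta hE hs h =>
      rcases ih h with ⟨h₁, h₂⟩ | ⟨a₁', h₁, h₂⟩
      · exact .inl ⟨.eta hE hs h₁, by simp only [Expr.size]; omega⟩
      -- The argument steps under the frame of `etaFun` on the left and under the related context on
      -- the right; these have the same prompts, so freshness carries over.
      · refine .inr ⟨_, h₁.plug _ (hf.congr h h₂ ?_), .eta hE hs h₂⟩
        rw [etaFun_prompts, hE.prompts_eq]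
  | reset p hr hf ih =>
    intro e' h
    cases h with
    | reset hp h =>
      cases hp
      rcases ih h with ⟨h₁, h₂⟩ | ⟨a₁', h₁, h₂⟩
      · exact .inl ⟨.reset (.prompt p) h₁, by simp only [Expr.size]; omega⟩
      · exact .inr ⟨_, .reset p h₁ (hf.congr h h₂ rfl), .reset (.prompt p) h₂⟩

theorem FreshFor.to_adm {e e₀ e₁ : Expr} {S : Set ℕ} (h : FreshFor e e₁ S) (ha : Adm e e₀) :
    FreshFor e₀ e₁ S := by
  rwa [FreshFor, ha.prompts_eq]

/-- A step on the right is matched by administrative steps and one further step on the left. -/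
theorem FrameRed.sim_right : ∀ {e e' e₁' : Expr}, ExprRel e e' → FrameRed e' e₁' →
    ∃ e₀ e₁, Adm e e₀ ∧ FrameRed e₀ e₁ ∧ ExprRel e₁ e₁' := by
  suffices H : ∀ n, ∀ e : Expr, e.size < n → ∀ e' e₁', ExprRel e e' → FrameRed e' e₁' →
      ∃ e₀ e₁, Adm e e₀ ∧ FrameRed e₀ e₁ ∧ ExprRel e₁ e₁' from
    fun {_ _ _} h hr => H _ _ (Nat.lt_succ_self _) _ _ h hr
  intro n
  induction n with
  | zero => exact fun e h => absurd h (Nat.not_lt_zero _)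
  | succ n ih =>
    intro e hn e' e₁' h hr
    cases h with
    | val h => exact absurd hr not_frameRed_val
    | @app a a' b b' ha hb =>
      simp only [Expr.size] at hn
      cases hr with
      | beta f' v' =>
        obtain ⟨w, hw, hww⟩ := ha.adm_val
        obtain ⟨v, hv, hvv⟩ := hb.adm_val
        cases hww with
        | lam hf =>
          exact ⟨_, _, (hw.plug (.appL .hole b)).trans (hv.plug (.appR _ .hole)), .beta _ _,
            hf.inst hvv⟩
      | appL _ hr hf =>
        obtain ⟨a₀, a₁, h₀, h₁, h₂⟩ := ih a (by omega) _ _ ha hr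
        refine ⟨.app a₀ b, .app a₁ b, h₀.plug (.appL .hole b), .appL b h₁ ?_, .app h₂ hb⟩
        exact (hf.congr_symm ha h₂ hb.prompts_eq).to_adm h₀
      | appR v' hr hf =>
        obtain ⟨v, hv, hvv⟩ := ha.adm_val
        obtain ⟨b₀, b₁, h₀, h₁, h₂⟩ := ih b (by omega) _ _ hb hr
        refine ⟨.app (.val v) b₀, .app (.val v) b₁,
          (hv.plug (.appL .hole b)).trans (h₀.plug (.appR v .hole)), .appR v h₁ ?_,
          .app (.val hvv) h₂⟩
        exact (hf.congr_symm hb h₂ hvv.prompts_eq).to_adm h₀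
    | gen h =>
      cases hr with
      | gen _ p hp => exact ⟨_, _, .refl, .gen _ p (h.prompts_eq ▸ hp), h.inst (.prompt p)⟩
    | @reset v v' e e' hv h =>
      simp only [Expr.size] at hn
      generalize hg : e' = g at hr
      cases hr with
      | resetVal p w =>
        subst hg
        cases hv
        obtain ⟨v, hv, hvv⟩ := h.adm_val
        exact ⟨_, _, hv.plug (.reset p .hole), .resetVal _ _, .val hvv⟩
      | capture p E' f' hp =>
        subst hg
        cases hv
        obtain ⟨E, _, f, h₀, hE, hq, hf⟩ := h.adm_plug_grab
        cases hq
        exact ⟨_, _, h₀.plug (.reset p .hole), .capture p E f (hE.surPr_eq ▸ hp),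
          hf.inst (.cont hE)⟩
      | reset p hr hf =>
        subst hg
        cases hv
        obtain ⟨a₀, a₁, h₀, h₁, h₂⟩ := ih e (by omega) _ _ h hr
        refine ⟨.reset (.prompt p) a₀, .reset (.prompt p) a₁, h₀.plug (.reset p .hole),
          .reset p h₁ ?_, .reset (.prompt p) h₂⟩
        exact (hf.congr_symm h h₂ rfl).to_adm h₀
    | grab hv h => cases hr
    | push hv h =>
      cases hr with
      | throw E' f' =>
        cases hv with
        | cont hE => exact ⟨_, _, .refl, .throw _ _, hE.plug h⟩
    | @eta F F' e e' hF hs h =>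
      -- If the argument is a value on the right, the step involves `F'`, and the instance is
      -- contracted before the smaller term is treated. Otherwise the step takes place inside the
      -- argument, because `F'` has no delimiter that could capture.
      by_cases hv : e'.IsValue
      · obtain ⟨w', rfl⟩ := hv
        obtain ⟨w, hw, hww⟩ := h.adm_val
        have hlt := hw.eta_size_lt F
        obtain ⟨e₀, e₁, h₁, h₂⟩ := ih _ (by omega) _ _ (hF.plug (.val hww)) hr
        exact ⟨e₀, e₁, (hw.eta F).trans h₁, h₂⟩
      · obtain ⟨e₂', rfl, hr, hf⟩ := FrameRed.of_plug hv (hF.surPr_eq ▸ hs) hr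
        obtain ⟨e₀, e₁, h₀, h₁, h₂⟩ := ih e (by simp only [Expr.size] at hn; omega) _ _ h hr
        refine ⟨_, _, h₀.plug (.appR (etaFun F) .hole), .appR _ h₁ ?_, .eta hF hs h₂⟩
        refine (hf.congr_symm h h₂ ?_).to_adm h₀
        rw [etaFun_prompts, hF.prompts_eq]

/-! ### Contextual equivalence -/

theorem Reds.tail {a b c : Expr} (h : Reds a b) (h' : FrameRed b c) : Reds a c :=
  Relation.ReflTransGen.tail h (red_iff_frameRed.2 h')

theorem Reds.trans {a b c : Expr} (h : Reds a b) (h' : Reds b c) : Reds a c :=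
  Relation.ReflTransGen.trans h h'

theorem Adm.reds {e e' : Expr} (h : Adm e e') : Reds e e' :=
  Relation.ReflTransGen.mono (fun _ _ h => red_iff_frameRed.2 h.1) _ _ h

theorem ExprRel.reds_left {e e₁ e' : Expr} (h : ExprRel e e') (hr : Reds e e₁) :
    ∃ e₁', Reds e' e₁' ∧ ExprRel e₁ e₁' := by
  induction hr with
  | refl => exact ⟨e', .refl, h⟩
  | tail _ hr ih =>
    obtain ⟨e₁', h₁, h₂⟩ := ih
    rcases (red_iff_frameRed.1 hr).sim_left h₂ with ⟨h₃, -⟩ | ⟨e₂', h₃, h₄⟩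
    · exact ⟨e₁', h₁, h₃⟩
    · exact ⟨e₂', h₁.tail h₃, h₄⟩

theorem ExprRel.reds_right {e e' e₁' : Expr} (h : ExprRel e e') (hr : Reds e' e₁') :
    ∃ e₁, Reds e e₁ ∧ ExprRel e₁ e₁' := by
  induction hr with
  | refl => exact ⟨e, .refl, h⟩
  | tail _ hr ih =>
    obtain ⟨e₁, h₁, h₂⟩ := ih
    obtain ⟨e₂, e₃, h₃, h₄, h₅⟩ := FrameRed.sim_right h₂ (red_iff_frameRed.1 hr)
    exact ⟨e₃, (h₁.trans h₃.reds).tail h₄, h₅⟩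

theorem ExprRel.isStuck_left {e e' : Expr} (h : ExprRel e e') (hs : e.IsStuck) :
    e'.IsStuck := by
  obtain ⟨E, p, f, hp, rfl⟩ := hs
  obtain ⟨E', _, f', rfl, hE, hq, -⟩ := h.plug_grab_left
  cases hq
  exact ⟨E', p, f', hE.surPr_eq ▸ hp, rfl⟩

theorem ExprRel.isStuck_right {e e' : Expr} (h : ExprRel e e') (hs : e'.IsStuck) :
    ∃ e₁, Adm e e₁ ∧ e₁.IsStuck := by
  obtain ⟨E', p, f', hp, rfl⟩ := hs
  obtain ⟨E, _, f, h₀, hE, hq, -⟩ := h.adm_plug_grab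
  cases hq
  exact ⟨_, h₀, E, p, f, hE.surPr_eq ▸ hp, rfl⟩

/-- A set of expressions in which every member reduces, in one or more steps, to a member
consists of diverging expressions. -/
theorem diverges_of_progress (P : Expr → Prop)
    (hP : ∀ e, P e → ∃ e₁ e₂, Red e e₁ ∧ Reds e₁ e₂ ∧ P e₂) {e : Expr} (he : P e) :
    Diverges e := by
  -- The set is enlarged to all expressions that reduce to a member. In the enlarged set one single
  -- step leads again to a member, so choice yields an infinite reduction.
  have hQ : ∀ e : {e // ∃ e₂, Reds e e₂ ∧ P e₂}, ∃ e' : {e // ∃ e₂, Reds e e₂ ∧ P e₂},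
      Red e.1 e'.1 := by
    rintro ⟨e, e₂, h, h₂⟩
    obtain rfl | ⟨e₁, h₁, h₃⟩ := Relation.ReflTransGen.cases_head h
    · obtain ⟨e₁, e₂, h₁, h₃, h₄⟩ := hP _ h₂
      exact ⟨⟨e₁, e₂, h₃, h₄⟩, h₁⟩
    · exact ⟨⟨e₁, e₂, h₃, h₂⟩, h₁⟩
  choose next hnext using hQ
  refine ⟨fun n => (next^[n] ⟨e, e, .refl, he⟩).1, rfl, fun n => ?_⟩
  simp only [Function.iterate_succ_apply']
  exact hnext _

theorem Diverges.exists_red {e : Expr} (h : Diverges e) : ∃ e₁, FrameRed e e₁ ∧ Diverges e₁ := by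
  obtain ⟨f, rfl, hf⟩ := h
  exact ⟨f 1, red_iff_frameRed.1 (hf 0), fun n => f (n + 1), rfl, fun n => hf (n + 1)⟩

/-- Steps that leave the right term in place shrink the left one, so an infinite left reduction
cannot consist of them alone. -/
theorem ExprRel.exists_red_of_diverges {e' : Expr} : ∀ {e : Expr}, ExprRel e e' → Diverges e →
    ∃ e₁ e₁', Red e' e₁' ∧ ExprRel e₁ e₁' ∧ Diverges e₁ := by
  suffices H : ∀ n, ∀ e : Expr, e.size < n → ExprRel e e' → Diverges e →
      ∃ e₁ e₁', Red e' e₁' ∧ ExprRel e₁ e₁' ∧ Diverges e₁ from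
    fun {_} h hd => H _ _ (Nat.lt_succ_self _) h hd
  intro n
  induction n with
  | zero => exact fun e h => absurd h (Nat.not_lt_zero _)
  | succ n ih =>
    intro e hn h hd
    obtain ⟨e₁, hr, hd⟩ := hd.exists_red
    rcases hr.sim_left h with ⟨h₁, h₂⟩ | ⟨e₁', h₁, h₂⟩
    · exact ih e₁ (by omega) h₁ hd
    · exact ⟨e₁, e₁', red_iff_frameRed.2 h₁, h₂, hd⟩

theorem ExprRel.diverges_left {e e' : Expr} (h : ExprRel e e') (hd : Diverges e) :
    Diverges e' := by
  refine diverges_of_progress (fun e' => ∃ e, ExprRel e e' ∧ Diverges e) ?_ ⟨e, h, hd⟩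
  rintro e' ⟨e, h, hd⟩
  obtain ⟨e₁, e₁', h₁, h₂⟩ := h.exists_red_of_diverges hd
  exact ⟨e₁', e₁', h₁, .refl, e₁, h₂⟩

theorem ExprRel.diverges_right {e e' : Expr} (h : ExprRel e e') (hd : Diverges e') :
    Diverges e := by
  refine diverges_of_progress (fun e => ∃ e', ExprRel e e' ∧ Diverges e') ?_ ⟨e', h, hd⟩
  rintro e ⟨e', h, hd⟩
  obtain ⟨e₁', hr, hd⟩ := hd.exists_red
  obtain ⟨e₀, e₁, h₀, h₁, h₂⟩ := FrameRed.sim_right h hr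
  obtain rfl | ⟨e₂, h₃, h₄⟩ := Relation.ReflTransGen.cases_head h₀
  · exact ⟨e₁, e₁, red_iff_frameRed.2 h₁, .refl, e₁', h₂, hd⟩
  · exact ⟨e₂, e₁, red_iff_frameRed.2 h₃.1, (Adm.reds h₄).tail h₁, e₁', h₂, hd⟩

theorem ExprRel.isError_left {e e' : Expr} (h : ExprRel e e') (he : e.IsError) : e'.IsError := by
  obtain ⟨hn, hv, hs⟩ := he
  -- A normal form has no administrative steps, so what the right term shows is already present on
  -- the left.
  have hadm : ∀ {e₁}, Adm e e₁ → e₁ = e := by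
    intro e₁ h₁
    obtain rfl | ⟨e₂, h₂, -⟩ := Relation.ReflTransGen.cases_head h₁
    · rfl
    · exact absurd ⟨e₂, red_iff_frameRed.2 h₂.1⟩ hn
  refine ⟨?_, ?_, ?_⟩
  · rintro ⟨e₁', hr⟩
    obtain ⟨e₀, e₁, h₀, h₁, -⟩ := FrameRed.sim_right h (red_iff_frameRed.1 hr)
    cases hadm h₀
    exact hn ⟨e₁, red_iff_frameRed.2 h₁⟩
  · rintro ⟨v', rfl⟩
    obtain ⟨v, h₀, -⟩ := h.adm_val
    exact hv ⟨v, (hadm h₀).symm⟩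
  · intro hs'
    obtain ⟨e₁, h₀, h₁⟩ := h.isStuck_right hs'
    cases hadm h₀
    exact hs h₁

/-- The left term may still reduce, but the right one cannot answer; each left step therefore
decreases the size, and a normal form is reached. -/
theorem ExprRel.isError_right {e' : Expr} (he : e'.IsError) : ∀ {e : Expr}, ExprRel e e' →
    ∃ e₁, Reds e e₁ ∧ e₁.IsError := by
  suffices H : ∀ n, ∀ e : Expr, e.size < n → ExprRel e e' → ∃ e₁, Reds e e₁ ∧ e₁.IsError from
    fun {_} h => H _ _ (Nat.lt_succ_self _) h
  intro n
  induction n with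
  | zero => exact fun e h => absurd h (Nat.not_lt_zero _)
  | succ n ih =>
    intro e hlt h
    obtain ⟨hn, hv, hs⟩ := he
    by_cases hr : NormalForm e
    · refine ⟨e, .refl, hr, ?_, fun hs' => hs (h.isStuck_left hs')⟩
      rintro ⟨v, rfl⟩
      obtain ⟨v', rfl, -⟩ := h.val_left
      exact hv ⟨v', rfl⟩
    · obtain ⟨e₁, hr⟩ := not_not.1 hr
      rcases (red_iff_frameRed.1 hr).sim_left h with ⟨h₁, h₂⟩ | ⟨e₁', h₁, -⟩
      · obtain ⟨e₂, h₃, h₄⟩ := ih e₁ (by omega) h₁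
        exact ⟨e₂, Relation.ReflTransGen.head hr h₃, h₄⟩
      · exact absurd ⟨e₁', red_iff_frameRed.2 h₁⟩ hn

/-- More is proved than the third clause asks: divergence is matched with divergence and errors with
errors. -/
theorem ExprRel.obsEquiv {e e' : Expr} (h : ExprRel e e') : ObsEquiv e e' := by
  refine ⟨⟨?_, ?_⟩, ⟨?_, ?_⟩, ⟨?_, ?_⟩⟩
  · rintro ⟨e₁, hr, v, rfl⟩
    obtain ⟨e₁', hr', h₁⟩ := h.reds_left hr
    obtain ⟨v', rfl, -⟩ := h₁.val_left
    exact ⟨_, hr', v', rfl⟩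
  · rintro ⟨e₁', hr', v', rfl⟩
    obtain ⟨e₁, hr, h₁⟩ := h.reds_right hr'
    obtain ⟨v, h₂, -⟩ := h₁.adm_val
    exact ⟨_, hr.trans h₂.reds, v, rfl⟩
  · rintro ⟨e₁, hr, hs⟩
    obtain ⟨e₁', hr', h₁⟩ := h.reds_left hr
    exact ⟨e₁', hr', h₁.isStuck_left hs⟩
  · rintro ⟨e₁', hr', hs⟩
    obtain ⟨e₁, hr, h₁⟩ := h.reds_right hr'
    obtain ⟨e₂, h₂, hs⟩ := h₁.isStuck_right hs
    exact ⟨e₂, hr.trans h₂.reds, hs⟩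
  · rintro (hd | ⟨e₁, hr, he⟩)
    · exact .inl (h.diverges_left hd)
    · obtain ⟨e₁', hr', h₁⟩ := h.reds_left hr
      exact .inr ⟨e₁', hr', h₁.isError_left he⟩
  · rintro (hd | ⟨e₁', hr', he⟩)
    · exact .inl (h.diverges_right hd)
    · obtain ⟨e₁, hr, h₁⟩ := h.reds_right hr'
      obtain ⟨e₂, h₂, he⟩ := ExprRel.isError_right he h₁
      exact .inr ⟨e₂, hr.trans h₂, he⟩

theorem ExprRel.ctxEquiv {e e' : Expr} (h : ExprRel e e') (he : e.fv = ∅) (he' : e'.fv = ∅) :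
    CtxEquiv e e' :=
  ⟨he, he', fun E _ _ => ((ECtxRel.refl E).plug h).obsEquiv⟩

/-! ### Filling of multi-hole contexts -/

/-- Pointwise related sequences of values. -/
abbrev EnvRel : List Val → List Val → Prop := List.Forall₂ ValRel

theorem EnvRel.get_left {v : Val} : ∀ {Γ Γ' : List Val} {i : ℕ}, EnvRel Γ Γ' → Γ[i]? = some v →
    ∃ v', Γ'[i]? = some v' ∧ ValRel v v'
  | _, _, i, .nil, hi => by simp at hi
  | _, _, 0, .cons h _, hi => by
      cases hi
      exact ⟨_, rfl, h⟩
  | _, _, i + 1, .cons _ h, hi => EnvRel.get_left (i := i) h hi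

theorem EnvRel.get_right {v' : Val} : ∀ {Γ Γ' : List Val} {i : ℕ}, EnvRel Γ Γ' →
    Γ'[i]? = some v' → ∃ v, Γ[i]? = some v ∧ ValRel v v'
  | _, _, i, .nil, hi => by simp at hi
  | _, _, 0, .cons h _, hi => by
      cases hi
      exact ⟨_, rfl, h⟩
  | _, _, i + 1, .cons _ h, hi => EnvRel.get_right (i := i) h hi

theorem EnvRel.shiftEnv {Γ Γ' : List Val} (h : EnvRel Γ Γ') :
    EnvRel (shiftEnv Γ) (PromptCalc.shiftEnv Γ') := by
  induction h with
  | nil => exact .nil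
  | cons h _ ih => exact .cons (h.rename _) ih

theorem EnvRel.prompts_eq {Γ Γ' : List Val} (h : EnvRel Γ Γ') :
    envPrompts Γ = envPrompts Γ' := by
  induction h with
  | nil => rfl
  | cons h _ ih =>
    ext p
    have := Set.ext_iff.1 ih p
    simp only [envPrompts, Set.mem_ofPred_eq, List.exists_mem_cons_iff, h.prompts_eq] at this ⊢
    rw [this]

theorem EnvRel.append {Γ Γ' Δ Δ' : List Val} (h : EnvRel Γ Γ') (h' : EnvRel Δ Δ') :
    EnvRel (Γ ++ Δ) (Γ' ++ Δ') := by
  induction h with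
  | nil => exact h'
  | cons h _ ih => exact .cons h ih

theorem contAt_eq_some {Γ : List Val} {i : ℕ} {E : ECtx} :
    contAt Γ i = some E ↔ Γ[i]? = some (.cont E) := by
  unfold contAt
  split <;> simp_all

theorem _root_.Option.Rel.bind_bind {α β : Type} {R : α → α → Prop} {S : β → β → Prop}
    {o o' : Option α} {f f' : α → Option β} (h : Option.Rel R o o')
    (hf : ∀ a a', R a a' → Option.Rel S (f a) (f' a')) :
    Option.Rel S (o >>= f) (o' >>= f') := by
  cases h with
  | some h => exact hf _ _ h
  | none => exact .none

theorem EnvRel.getElem? {Γ Γ' : List Val} (h : EnvRel Γ Γ') (i : ℕ) :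
    Option.Rel ValRel (Γ[i]?) (Γ'[i]?) := by
  rcases hi : Γ[i]? with _ | v
  · rcases hi' : Γ'[i]? with _ | v'
    · exact .none
    · obtain ⟨v, hv, -⟩ := h.get_right hi'
      rw [hi] at hv
      cases hv
  · obtain ⟨v', hv', hv⟩ := h.get_left hi
    rw [hv']
    exact .some hv

theorem EnvRel.contAt {Γ Γ' : List Val} (h : EnvRel Γ Γ') (i : ℕ) :
    Option.Rel ECtxRel (contAt Γ i) (PromptCalc.contAt Γ' i) := by
  have := h.getElem? i
  unfold PromptCalc.contAt
  generalize Γ[i]? = o, Γ'[i]? = o' at this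
  cases this with
  | none => exact .none
  | some h =>
    cases h with
    | cont h => exact .some h
    | _ => exact .none

theorem EnvRel.promptAt {Γ Γ' : List Val} (h : EnvRel Γ Γ') (i : ℕ) :
    Option.Rel (fun p q => p = q) (promptAt Γ i) (PromptCalc.promptAt Γ' i) := by
  have := h.getElem? i
  unfold PromptCalc.promptAt
  generalize Γ[i]? = o, Γ'[i]? = o' at this
  cases this with
  | none => exact .none
  | some h =>
    cases h with
    | prompt p => exact .some rfl
    | _ => exact .none

mutual
-- Related values have the same outermost constructor, so filling is defined for both sequences or
-- for neither; `Option.Rel` records this together with the relation of the results.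
theorem MCtx.fill_rel : ∀ (C : MCtx) {Γ Γ' : List Val}, EnvRel Γ Γ' →
    Option.Rel ExprRel (C.fill Γ) (C.fill Γ')
  | .val C, _, _, h => by
      simp only [MCtx.fill]
      exact (C.fill_rel h).bind_bind fun _ _ h₁ => .some (.val h₁)
  | .app C D, _, _, h => by
      simp only [MCtx.fill]
      exact (C.fill_rel h).bind_bind fun _ _ h₁ => (D.fill_rel h).bind_bind fun _ _ h₂ =>
        .some (.app h₁ h₂)
  | .gen C, _, _, h => by
      simp only [MCtx.fill]
      exact (C.fill_rel h.shiftEnv).bind_bind fun _ _ h₁ => .some (.gen h₁)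
  | .reset C D, _, _, h => by
      simp only [MCtx.fill]
      exact (C.fill_rel h).bind_bind fun _ _ h₁ => (D.fill_rel h).bind_bind fun _ _ h₂ =>
        .some (.reset h₁ h₂)
  | .grab C D, _, _, h => by
      simp only [MCtx.fill]
      exact (C.fill_rel h).bind_bind fun _ _ h₁ => (D.fill_rel h.shiftEnv).bind_bind
        fun _ _ h₂ => .some (.grab h₁ h₂)
  | .push C D, _, _, h => by
      simp only [MCtx.fill]
      exact (C.fill_rel h).bind_bind fun _ _ h₁ => (D.fill_rel h).bind_bind fun _ _ h₂ =>
        .some (.push h₁ h₂)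
  | .star i C, _, _, h => by
      simp only [MCtx.fill]
      exact (h.contAt i).bind_bind fun _ _ h₁ => (C.fill_rel h).bind_bind fun _ _ h₂ =>
        .some (h₁.plug h₂)
theorem MVCtx.fill_rel : ∀ (C : MVCtx) {Γ Γ' : List Val}, EnvRel Γ Γ' →
    Option.Rel ValRel (C.fill Γ) (C.fill Γ')
  | .var n, _, _, _ => .some (.var n)
  | .lam C, _, _, h => by
      simp only [MVCtx.fill]
      exact (C.fill_rel h.shiftEnv).bind_bind fun _ _ h₁ => .some (.lam h₁)
  | .cont C, _, _, h => by
      simp only [MVCtx.fill]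
      exact (C.fill_rel h).bind_bind fun _ _ h₁ => .some (.cont h₁)
  | .hole i, _, _, h => h.getElem? i
theorem MECtx.fill_rel : ∀ (C : MECtx) {Γ Γ' : List Val}, EnvRel Γ Γ' →
    Option.Rel ECtxRel (C.fill Γ) (C.fill Γ')
  | .hole, _, _, _ => .some .hole
  | .appL C D, _, _, h => by
      simp only [MECtx.fill]
      exact (C.fill_rel h).bind_bind fun _ _ h₁ => (D.fill_rel h).bind_bind fun _ _ h₂ =>
        .some (.appL h₁ h₂)
  | .appR C D, _, _, h => by
      simp only [MECtx.fill]
      exact (C.fill_rel h).bind_bind fun _ _ h₁ => (D.fill_rel h).bind_bind fun _ _ h₂ =>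
        .some (.appR h₁ h₂)
  | .reset i C, _, _, h => by
      simp only [MECtx.fill]
      exact (h.promptAt i).bind_bind fun p _ h₁ => (C.fill_rel h).bind_bind fun _ _ h₂ =>
        .some (h₁ ▸ .reset p h₂)
  | .star i C, _, _, h => by
      simp only [MECtx.fill]
      exact (h.contAt i).bind_bind fun _ _ h₁ => (C.fill_rel h).bind_bind fun _ _ h₂ =>
        .some (h₁.comp h₂)
end

/-- Sequences of closed values. -/
def ClosedEnv (Γ : List Val) : Prop := ∀ v ∈ Γ, v.fv = ∅

theorem ClosedEnv.shiftEnv {Γ : List Val} (h : ClosedEnv Γ) : ClosedEnv (shiftEnv Γ) := by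
  intro w hw
  obtain ⟨v, hv, rfl⟩ := List.mem_map.1 hw
  exact Set.subset_empty_iff.1 ((Val.fv_rename _ v).trans (by rw [h v hv, Set.image_empty]))

theorem ClosedEnv.getElem? {Γ : List Val} (h : ClosedEnv Γ) {i : ℕ} {v : Val}
    (hi : Γ[i]? = some v) : v.fv = ∅ :=
  h v (List.mem_of_getElem? hi)

theorem fv_pred_mono {S T : Set ℕ} (h : S ⊆ T) : {n | n + 1 ∈ S} ⊆ {n | n + 1 ∈ T} :=
  fun _ hn => h hn

mutual
theorem MCtx.fv_fill : ∀ (C : MCtx) {Γ : List Val} {e : Expr}, ClosedEnv Γ →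
    C.fill Γ = some e → e.fv ⊆ C.fv
  | .val C, _, e, h, he => by
      simp only [MCtx.fill, bind, pure, Option.bind_eq_some_iff, Option.some.injEq] at he
      obtain ⟨a, ha, rfl⟩ := he
      exact C.fv_fill h ha
  | .app C D, _, e, h, he => by
      simp only [MCtx.fill, bind, pure, Option.bind_eq_some_iff, Option.some.injEq] at he
      obtain ⟨a, ha, b, hb, rfl⟩ := he
      exact Set.union_subset_union (C.fv_fill h ha) (D.fv_fill h hb)
  | .gen C, _, e, h, he => by
      simp only [MCtx.fill, bind, pure, Option.bind_eq_some_iff, Option.some.injEq] at he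
      obtain ⟨a, ha, rfl⟩ := he
      exact fv_pred_mono (C.fv_fill h.shiftEnv ha)
  | .reset C D, _, e, h, he => by
      simp only [MCtx.fill, bind, pure, Option.bind_eq_some_iff, Option.some.injEq] at he
      obtain ⟨a, ha, b, hb, rfl⟩ := he
      exact Set.union_subset_union (C.fv_fill h ha) (D.fv_fill h hb)
  | .grab C D, _, e, h, he => by
      simp only [MCtx.fill, bind, pure, Option.bind_eq_some_iff, Option.some.injEq] at he
      obtain ⟨a, ha, b, hb, rfl⟩ := he
      exact Set.union_subset_union (C.fv_fill h ha) (fv_pred_mono (D.fv_fill h.shiftEnv hb))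
  | .push C D, _, e, h, he => by
      simp only [MCtx.fill, bind, pure, Option.bind_eq_some_iff, Option.some.injEq] at he
      obtain ⟨a, ha, b, hb, rfl⟩ := he
      exact Set.union_subset_union (C.fv_fill h ha) (D.fv_fill h hb)
  | .star i C, _, e, h, he => by
      simp only [MCtx.fill, bind, pure, Option.bind_eq_some_iff, Option.some.injEq] at he
      obtain ⟨E, hE, b, hb, rfl⟩ := he
      have hE : E.fv = ∅ := h.getElem? (contAt_eq_some.1 hE)
      rw [ECtx.fv_plug, hE, Set.empty_union]
      exact C.fv_fill h hb
theorem MVCtx.fv_fill : ∀ (C : MVCtx) {Γ : List Val} {v : Val}, ClosedEnv Γ →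
    C.fill Γ = some v → v.fv ⊆ C.fv
  | .var n, _, e, h, he => by
      simp only [MVCtx.fill, Option.some.injEq] at he
      subst he
      exact subset_rfl
  | .lam C, _, e, h, he => by
      simp only [MVCtx.fill, bind, pure, Option.bind_eq_some_iff, Option.some.injEq] at he
      obtain ⟨a, ha, rfl⟩ := he
      exact fv_pred_mono (C.fv_fill h.shiftEnv ha)
  | .cont C, _, e, h, he => by
      simp only [MVCtx.fill, bind, pure, Option.bind_eq_some_iff, Option.some.injEq] at he
      obtain ⟨a, ha, rfl⟩ := he
      exact C.fv_fill h ha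
  | .hole i, _, e, h, he => (h.getElem? he).subset
theorem MECtx.fv_fill : ∀ (C : MECtx) {Γ : List Val} {E : ECtx}, ClosedEnv Γ →
    C.fill Γ = some E → E.fv ⊆ C.fv
  | .hole, _, e, h, he => by
      simp only [MECtx.fill, Option.some.injEq] at he
      subst he
      exact subset_rfl
  | .appL C D, _, e, h, he => by
      simp only [MECtx.fill, bind, pure, Option.bind_eq_some_iff, Option.some.injEq] at he
      obtain ⟨a, ha, b, hb, rfl⟩ := he
      exact Set.union_subset_union (C.fv_fill h ha) (D.fv_fill h hb)
  | .appR C D, _, e, h, he => by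
      simp only [MECtx.fill, bind, pure, Option.bind_eq_some_iff, Option.some.injEq] at he
      obtain ⟨a, ha, b, hb, rfl⟩ := he
      exact Set.union_subset_union (C.fv_fill h ha) (D.fv_fill h hb)
  | .reset i C, _, e, h, he => by
      simp only [MECtx.fill, bind, pure, Option.bind_eq_some_iff, Option.some.injEq] at he
      obtain ⟨p, -, b, hb, rfl⟩ := he
      have hbC : b.fv ⊆ C.fv := C.fv_fill h hb
      exact hbC
  | .star i C, _, e, h, he => by
      simp only [MECtx.fill, bind, pure, Option.bind_eq_some_iff, Option.some.injEq] at he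
      obtain ⟨E, hE, b, hb, rfl⟩ := he
      have hE : E.fv = ∅ := h.getElem? (contAt_eq_some.1 hE)
      rw [ECtx.fv_comp, hE, Set.empty_union]
      exact C.fv_fill h hb
end

theorem optionRel_exists {α : Type} {R : α → α → Prop} {o o' : Option α}
    (h : Option.Rel R o o') :
    (∀ a, o = some a → ∃ a', o' = some a' ∧ R a a') ∧
      ∀ a', o' = some a' → ∃ a, o = some a ∧ R a a' := by
  cases h with
  | none => exact ⟨nofun, nofun⟩
  | some h =>
    refine ⟨fun a ha => ?_, fun a ha => ?_⟩
    · cases ha; exact ⟨_, rfl, h⟩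
    · cases ha; exact ⟨_, rfl, h⟩

/-! ### Transitions -/

theorem State.proper_of {Γ : List Val} {e : Expr} (hΓ : ClosedEnv Γ) (he : e.fv = ∅) :
    (State.of Γ e).Proper := by
  by_cases hv : e.IsValue
  · obtain ⟨v, rfl⟩ := hv
    intro w hw
    rcases List.mem_append.1 hw with hw | hw
    · exact hΓ w hw
    · rw [List.mem_singleton.1 hw]; exact he
  · cases e with
    | val v => exact absurd ⟨v, rfl⟩ hv
    | _ => exact ⟨hΓ, he, hv⟩

theorem State.of_eq_run {Γ : List Val} {e : Expr} (he : ¬ e.IsValue) :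
    State.of Γ e = .run Γ e := by
  cases e with
  | val v => exact absurd ⟨v, rfl⟩ he
  | _ => rfl

theorem Step.proper {s t : State} {a : Label} (h : Step s a t) (hs : s.Proper) : t.Proper := by
  cases h with
  | tau Γ e₁ e₂ h hf =>
    exact State.proper_of hs.1
      (Set.subset_empty_iff.1 ((red_iff_frameRed.1 h).fv_subset.trans hs.2.1.subset))
  | lam Γ i e Cv v hi hC hv =>
    refine State.proper_of hs (Set.subset_empty_iff.1 ((Expr.fv_inst _ _).trans ?_))
    have he : {n | n + 1 ∈ e.fv} = ∅ := ClosedEnv.getElem? hs hi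
    rw [he, Set.empty_union, ← hC]
    exact Cv.fv_fill hs hv
  | val Γ => exact hs
  | ctx Γ i E Cv v hi hC hv =>
    refine State.proper_of hs (Set.subset_empty_iff.1 ?_)
    have hE : E.fv = ∅ := ClosedEnv.getElem? hs hi
    rw [ECtx.fv_plug, hE, Set.empty_union, ← hC]
    exact Cv.fv_fill hs hv
  | decomp Γ i j p E₁ E₂ hi hj hp =>
    have hE : (E₁.comp (.reset p E₂)).fv = ∅ := ClosedEnv.getElem? hs hi
    rw [ECtx.fv_comp, Set.union_empty_iff] at hE
    intro w hw
    rcases List.mem_append.1 hw with hw | hw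
    · exact hs w hw
    · simp only [List.mem_cons, List.not_mem_nil, or_false] at hw
      rcases hw with rfl | rfl
      · exact hE.1
      · exact hE.2
  | prompt => exact hs
  | newPrompt Γ p hp =>
    intro w hw
    rcases List.mem_append.1 hw with hw | hw
    · exact hs w hw
    · rw [List.mem_singleton.1 hw]; rfl
  | stuck Γ E p e e' 𝔼 F hp hC hF h =>
    obtain ⟨hΓ, he, -⟩ := hs
    have hF : F.fv = ∅ := Set.subset_empty_iff.1 (hC ▸ 𝔼.fv_fill hΓ hF)
    have hFe : (F.plug (E.plug (.grab (.prompt p) e))).fv = ∅ := by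
      rw [ECtx.fv_plug, hF, he, Set.empty_union]
    rcases h with h | ⟨-, rfl⟩
    · exact State.proper_of hΓ
        (Set.subset_empty_iff.1 ((red_iff_frameRed.1 h).fv_subset.trans hFe.subset))
    · exact State.proper_of hΓ hFe

/-- The candidate bisimulation on states that need not be proper. A value on the right may be
related to an expression that is no value yet. -/
inductive StateRel : State → State → Prop
  | env {Γ Γ' : List Val} (h : EnvRel Γ Γ') : StateRel (.env Γ) (.env Γ')
  | run {Γ Γ' : List Val} {e e' : Expr} (h : EnvRel Γ Γ') (he : ExprRel e e') :
      StateRel (.run Γ e) (.run Γ' e')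
  | eval {Γ Γ' : List Val} {e : Expr} {v' : Val} (h : EnvRel Γ Γ')
      (he : ExprRel e (.val v')) : StateRel (.run Γ e) (.env (Γ' ++ [v']))

theorem StateRel.of {Γ Γ' : List Val} {e e' : Expr} (h : EnvRel Γ Γ') (he : ExprRel e e') :
    StateRel (.of Γ e) (.of Γ' e') := by
  by_cases hv : e.IsValue
  · obtain ⟨v, rfl⟩ := hv
    obtain ⟨v', rfl, hv⟩ := he.val_left
    exact .env (h.append (.cons hv .nil))
  · rw [State.of_eq_run hv]
    by_cases hv' : e'.IsValue
    · obtain ⟨v', rfl⟩ := hv'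
      exact .eval h he
    · rw [State.of_eq_run hv']
      exact .run h he

theorem WeakStep.single {s t : State} {a : Label} (h : Step s a t) : WeakStep s a t := by
  by_cases ha : a = .tau
  · subst ha
    exact .inl ⟨rfl, .single h⟩
  · exact .inr ⟨ha, s, t, .refl, h, .refl⟩

theorem WeakStep.of_weakTau {s s' t : State} {a : Label} (h : WeakTau s s') (h' : Step s' a t) :
    WeakStep s a t := by
  by_cases ha : a = .tau
  · subst ha
    exact .inl ⟨rfl, h.tail h'⟩
  · exact .inr ⟨ha, s', t, h, h', .refl⟩

/-- Administrative steps create no prompt, so they are silent transitions next to any sequence. -/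
theorem Adm.weakTau {Γ : List Val} {e e' : Expr} (h : Adm e e') :
    WeakTau (.of Γ e) (.of Γ e') := by
  induction h with
  | refl => exact .refl
  | tail _ h ih =>
    refine ih.tail ?_
    rw [State.of_eq_run fun ⟨v, hv⟩ => not_frameRed_val (hv ▸ h.1)]
    exact .tau Γ _ _ (red_iff_frameRed.2 h.1) (FreshFor.of_prompts_subset h.2.1.subset _)

/-- The transitions of related evaluated sequences match, from left to right. -/
theorem EnvRel.sim_left {Γ Γ' : List Val} (h : EnvRel Γ Γ') {a : Label} {s : State}
    (hs : Step (.env Γ) a s) : ∃ s', Step (.env Γ') a s' ∧ StateRel s s' := by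
  cases hs with
  | lam _ i e Cv v hi hC hv =>
    obtain ⟨_, hi', hw⟩ := h.get_left hi
    obtain ⟨v', hv', hvv⟩ := (optionRel_exists (Cv.fill_rel h)).1 v hv
    cases hw with
    | lam he => exact ⟨_, .lam Γ' i _ Cv v' hi' hC hv', .of h (he.inst hvv)⟩
  | val => exact ⟨_, .val Γ', .env h⟩
  | ctx _ i E Cv v hi hC hv =>
    obtain ⟨_, hi', hw⟩ := h.get_left hi
    obtain ⟨v', hv', hvv⟩ := (optionRel_exists (Cv.fill_rel h)).1 v hv
    cases hw with
    | cont hE => exact ⟨_, .ctx Γ' i _ Cv v' hi' hC hv', .of h (hE.plug (.val hvv))⟩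
  | decomp _ i j p E₁ E₂ hi hj hp =>
    obtain ⟨_, hi', hw⟩ := h.get_left hi
    obtain ⟨_, hj', hq⟩ := h.get_left hj
    cases hq
    generalize hg : E₁.comp (.reset p E₂) = g at hw
    cases hw with
    | cont hE =>
      subst hg
      obtain ⟨E₁', E₂', rfl, h₁, h₂⟩ := hE.comp_reset_left
      exact ⟨_, .decomp Γ' i j p E₁' E₂' hi' hj' (h₂.surPr_eq ▸ hp),
        .env (h.append (.cons (.cont h₁) (.cons (.cont h₂) .nil)))⟩
  | prompt _ i j p hi hj =>
    obtain ⟨_, hi', hw⟩ := h.get_left hi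
    obtain ⟨_, hj', hq⟩ := h.get_left hj
    cases hq
    cases hw
    exact ⟨_, .prompt Γ' i j p hi' hj', .env h⟩
  | newPrompt _ p hp =>
    exact ⟨_, .newPrompt Γ' p (h.prompts_eq ▸ hp), .env (h.append (.cons (.prompt p) .nil))⟩

/-- The transitions of related evaluated sequences match, from right to left. -/
theorem EnvRel.sim_right {Γ Γ' : List Val} (h : EnvRel Γ Γ') {a : Label} {s' : State}
    (hs : Step (.env Γ') a s') : ∃ s, Step (.env Γ) a s ∧ StateRel s s' := by
  cases hs with
  | lam _ i e Cv v hi hC hv =>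
    obtain ⟨_, hi', hw⟩ := h.get_right hi
    obtain ⟨v', hv', hvv⟩ := (optionRel_exists (Cv.fill_rel h)).2 v hv
    cases hw with
    | lam he => exact ⟨_, .lam Γ i _ Cv v' hi' hC hv', .of h (he.inst hvv)⟩
  | val => exact ⟨_, .val Γ, .env h⟩
  | ctx _ i E Cv v hi hC hv =>
    obtain ⟨_, hi', hw⟩ := h.get_right hi
    obtain ⟨v', hv', hvv⟩ := (optionRel_exists (Cv.fill_rel h)).2 v hv
    cases hw with
    | cont hE => exact ⟨_, .ctx Γ i _ Cv v' hi' hC hv', .of h (hE.plug (.val hvv))⟩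
  | decomp _ i j p E₁ E₂ hi hj hp =>
    obtain ⟨_, hi', hw⟩ := h.get_right hi
    obtain ⟨_, hj', hq⟩ := h.get_right hj
    cases hq
    generalize hg : E₁.comp (.reset p E₂) = g at hw
    cases hw with
    | cont hE =>
      obtain ⟨E₁', E₂', rfl, h₁, h₂⟩ := hE.comp_reset_right hg.symm
      exact ⟨_, .decomp Γ i j p E₁' E₂' hi' hj' (h₂.surPr_eq ▸ hp),
        .env (h.append (.cons (.cont h₁) (.cons (.cont h₂) .nil)))⟩
  | prompt _ i j p hi hj =>
    obtain ⟨_, hi', hw⟩ := h.get_right hi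
    obtain ⟨_, hj', hq⟩ := h.get_right hj
    cases hq
    cases hw
    exact ⟨_, .prompt Γ i j p hi' hj', .env h⟩
  | newPrompt _ p hp =>
    exact ⟨_, .newPrompt Γ p (h.prompts_eq ▸ hp), .env (h.append (.cons (.prompt p) .nil))⟩

/-- The captures of related capture operators in related contexts match, from left to right. -/
theorem ECtxRel.red_grab_left {E E' : ECtx} {f f' c : Expr} {p : ℕ} (hE : ECtxRel E E')
    (hf : ExprRel f f') (hr : Red (E.plug (.grab (.prompt p) f)) c) :
    ∃ c', Red (E'.plug (.grab (.prompt p) f')) c' ∧ ExprRel c c' := by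
  obtain ⟨E₁, E₂, rfl, hp, rfl⟩ := (red_iff_frameRed.1 hr).plug_grab
  obtain ⟨E₁', E₂', rfl, h₁, h₂⟩ := hE.comp_reset_left
  exact ⟨_, red_iff_frameRed.2 (.capture_plug E₁' E₂' f' (h₂.surPr_eq ▸ hp)),
    h₁.plug (hf.inst (.cont h₂))⟩

/-- The captures of related capture operators in related contexts match, from right to left. -/
theorem ECtxRel.red_grab_right {E E' : ECtx} {f f' c' : Expr} {p : ℕ} (hE : ECtxRel E E')
    (hf : ExprRel f f') (hr : Red (E'.plug (.grab (.prompt p) f')) c') :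
    ∃ c, Red (E.plug (.grab (.prompt p) f)) c ∧ ExprRel c c' := by
  obtain ⟨E₁', E₂', rfl, hp, rfl⟩ := (red_iff_frameRed.1 hr).plug_grab
  obtain ⟨E₁, E₂, rfl, h₁, h₂⟩ := hE.comp_reset_right rfl
  exact ⟨_, red_iff_frameRed.2 (.capture_plug E₁ E₂ f (h₂.surPr_eq ▸ hp)),
    h₁.plug (hf.inst (.cont h₂))⟩

/-- The stuttering case needs normality to transfer, which holds because captures match in both
directions without administrative steps. -/
theorem ECtxRel.redBis_grab_left {E E' : ECtx} {f f' c : Expr} {p : ℕ} (hE : ECtxRel E E')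
    (hf : ExprRel f f') (hr : RedBis (E.plug (.grab (.prompt p) f)) c) :
    ∃ c', RedBis (E'.plug (.grab (.prompt p) f')) c' ∧ ExprRel c c' := by
  rcases hr with hr | ⟨hn, rfl⟩
  · obtain ⟨c', hr', hc⟩ := hE.red_grab_left hf hr
    exact ⟨c', .inl hr', hc⟩
  · refine ⟨_, .inr ⟨?_, rfl⟩, hE.plug (.grab (.prompt p) hf)⟩
    rintro ⟨c', hr'⟩
    obtain ⟨c, hr, -⟩ := hE.red_grab_right hf hr'
    exact hn ⟨c, hr⟩

theorem ECtxRel.redBis_grab_right {E E' : ECtx} {f f' c' : Expr} {p : ℕ} (hE : ECtxRel E E')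
    (hf : ExprRel f f') (hr : RedBis (E'.plug (.grab (.prompt p) f')) c') :
    ∃ c, RedBis (E.plug (.grab (.prompt p) f)) c ∧ ExprRel c c' := by
  rcases hr with hr | ⟨hn, rfl⟩
  · obtain ⟨c', hr', hc⟩ := hE.red_grab_right hf hr
    exact ⟨c', .inl hr', hc⟩
  · refine ⟨_, .inr ⟨?_, rfl⟩, hE.plug (.grab (.prompt p) hf)⟩
    rintro ⟨c', hr'⟩
    obtain ⟨c, hr, -⟩ := hE.red_grab_left hf hr'
    exact hn ⟨c, hr⟩

-- The lifted relation as a bisimulation.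

theorem StateRel.sim_left {s t s' : State} {a : Label} (h : StateRel s t) (ht : t.Proper)
    (hs : Step s a s') : ∃ t', WeakStep t a t' ∧ StateRel s' t' := by
  cases h with
  | env h =>
    obtain ⟨t', h₁, h₂⟩ := h.sim_left hs
    exact ⟨t', .single h₁, h₂⟩
  | @run Γ Γ' e e' h he =>
    cases hs with
    | tau _ _ e₁ hr hf =>
      rcases (red_iff_frameRed.1 hr).sim_left he with ⟨h₁, -⟩ | ⟨e₁', h₁, h₂⟩
      -- A left step that keeps the relation is answered by no step at all.
      · refine ⟨.run Γ' e', .inl ⟨rfl, .refl⟩, ?_⟩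
        rw [← State.of_eq_run ht.2.2]
        exact .of h h₁
      · exact ⟨_, .single (.tau Γ' e' e₁' (red_iff_frameRed.2 h₁)
          (FreshFor.congr hf he h₂ h.prompts_eq)), .of h h₂⟩
    | stuck _ E p f c 𝔼 F hp hC hF hr =>
      obtain ⟨E', _, f', rfl, hE, hq, hf⟩ := he.plug_grab_left
      cases hq
      obtain ⟨F', hF', hFF⟩ := (optionRel_exists (𝔼.fill_rel h)).1 F hF
      rw [← ECtx.plug_comp] at hr
      -- The filled testing context and the context of the stuck term are composed into one pair of
      -- related contexts around the capture operator.
      obtain ⟨c', hr', hc⟩ := (hFF.comp hE).redBis_grab_left hf hr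
      rw [ECtx.plug_comp] at hr'
      exact ⟨_, .single (.stuck Γ' E' p f' c' 𝔼 F' (hE.surPr_eq ▸ hp) hC hF' hr'), .of h hc⟩
  | @eval Γ Γ' e v' h he =>
    cases hs with
    | tau _ _ e₁ hr hf =>
      rcases (red_iff_frameRed.1 hr).sim_left he with ⟨h₁, -⟩ | ⟨e₁', h₁, h₂⟩
      · exact ⟨.env (Γ' ++ [v']), .inl ⟨rfl, .refl⟩, .of (e' := .val v') h h₁⟩
      · exact absurd h₁ not_frameRed_val
    | stuck _ E p f c 𝔼 F hp hC hF hr =>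
      obtain ⟨E', _, f', h₁, -⟩ := he.plug_grab_left
      exact nomatch (ECtx.plug_eq_val h₁.symm).2

theorem StateRel.sim_right {s t t' : State} {a : Label} (h : StateRel s t) (hs : s.Proper)
    (ht : Step t a t') : ∃ s', WeakStep s a s' ∧ StateRel s' t' := by
  cases h with
  | env h =>
    obtain ⟨t', h₁, h₂⟩ := h.sim_right ht
    exact ⟨t', .single h₁, h₂⟩
  | @run Γ Γ' e e' h he =>
    rw [← State.of_eq_run hs.2.2]
    cases ht with
    | tau _ _ e₁' hr hf =>
      obtain ⟨e₀, e₁, h₀, h₁, h₂⟩ := FrameRed.sim_right he (red_iff_frameRed.1 hr)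
      refine ⟨_, .of_weakTau h₀.weakTau ?_, .of h h₂⟩
      rw [State.of_eq_run fun ⟨v, hv⟩ => not_frameRed_val (hv ▸ h₁)]
      exact .tau Γ e₀ e₁ (red_iff_frameRed.2 h₁)
        ((FreshFor.congr_symm hf he h₂ h.prompts_eq).to_adm h₀)
    | stuck _ E' p f' c' 𝔼 F' hp hC hF' hr =>
      obtain ⟨E, _, f, h₀, hE, hq, hf⟩ := he.adm_plug_grab
      cases hq
      obtain ⟨F, hF, hFF⟩ := (optionRel_exists (𝔼.fill_rel h)).2 F' hF'
      rw [← ECtx.plug_comp] at hr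
      obtain ⟨c, hr', hc⟩ := (hFF.comp hE).redBis_grab_right hf hr
      rw [ECtx.plug_comp] at hr'
      refine ⟨_, .of_weakTau h₀.weakTau ?_, .of h hc⟩
      rw [State.of_eq_run fun ⟨v, hv⟩ => nomatch (ECtx.plug_eq_val hv).2]
      exact .stuck Γ E p f c 𝔼 F (hE.surPr_eq ▸ hp) hC hF hr'
  | @eval Γ Γ' e v' h he =>
    -- The left expression first evaluates silently to a related value; then the transitions of two
    -- related sequences are compared.
    obtain ⟨v, h₀, hv⟩ := he.adm_val
    obtain ⟨s', h₁, h₂⟩ := (h.append (.cons hv .nil)).sim_right ht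
    rw [← State.of_eq_run hs.2.2]
    exact ⟨s', .of_weakTau h₀.weakTau h₁, h₂⟩

theorem WeakTau.proper {s t : State} (h : WeakTau s t) (hs : s.Proper) : t.Proper := by
  induction h with
  | refl => exact hs
  | tail _ h ih => exact h.proper ih

theorem WeakStep.proper {s t : State} {a : Label} (h : WeakStep s a t) (hs : s.Proper) :
    t.Proper := by
  rcases h with ⟨-, h⟩ | ⟨-, s', t', h₁, h₂, h₃⟩
  · exact h.proper hs
  · exact h₃.proper (h₂.proper (h₁.proper hs))

theorem isStarBisimulation_stateRel :
    IsStarBisimulation fun s t => StateRel s t ∧ s.Proper ∧ t.Proper := by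
  have hl : ∀ s t, (StateRel s t ∧ s.Proper ∧ t.Proper) → ∀ a s', Step s a s' →
      ∃ t', WeakStep t a t' ∧ StateRel s' t' ∧ s'.Proper ∧ t'.Proper := by
    rintro s t ⟨h, hs, ht⟩ a s' hst
    obtain ⟨t', h₁, h₂⟩ := h.sim_left ht hst
    exact ⟨t', h₁, h₂, hst.proper hs, h₁.proper ht⟩
  have hr : ∀ s t, (StateRel s t ∧ s.Proper ∧ t.Proper) → ∀ a t', Step t a t' →
      ∃ s', WeakStep s a s' ∧ StateRel s' t' ∧ s'.Proper ∧ t'.Proper := by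
    rintro s t ⟨h, hs, ht⟩ a t' hst
    obtain ⟨s', h₁, h₂⟩ := h.sim_right hs hst
    exact ⟨s', h₁, h₂, h₁.proper hs, hst.proper ht⟩
  exact ⟨fun s t h => h.2, fun s t h => h, fun s t h => h, fun s t h =>
    ⟨fun a s' _ => hl s t h a s', fun a s' _ => hl s t h a s', fun a t' _ => hr s t h a t',
      fun a t' _ => hr s t h a t'⟩⟩

theorem ExprRel.starBisimExpr {e e' : Expr} (h : ExprRel e e') (he : e.fv = ∅)
    (he' : e'.fv = ∅) : StarBisimExpr e e' :=
  ⟨_, isStarBisimulation_stateRel, .of .nil h, State.proper_of nofun he, State.proper_of nofun he'⟩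

-- The axiom as an instance of the congruence.

theorem ExprRel.lamVars {e e' : Expr} (h : ExprRel e e') :
    ∀ xs : List ℕ, ExprRel (lamVars xs e) (PromptCalc.lamVars xs e')
  | [] => h
  | _ :: xs => .val (.lam ((ExprRel.lamVars h xs).rename _))

theorem ExprRel.beta_omega {x : ℕ} {E : ECtx} (hx : x ∉ E.fv) (hE : E.surPr = ∅) (e : Expr) :
    ExprRel (.app (.val (lamVar x (E.plug (.val (.var x))))) e) (E.plug e) := by
  rw [lamVar_plug_var hx]
  exact .eta (.refl E) hE (.refl e)

theorem fv_beta_omega (x : ℕ) (E : ECtx) (e : Expr) :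
    (Expr.app (.val (lamVar x (E.plug (.val (.var x))))) e).fv ⊆ E.fv ∪ e.fv := by
  refine Set.union_subset_union_left _ ((fv_lamVar _ _).trans ?_)
  rw [ECtx.fv_plug]
  rintro n ⟨h | h, hn⟩
  · exact h
  · exact absurd h hn

end PromptCalc

theorem mainTheorem9 (x : ℕ) (E : PromptCalc.ECtx) (e : PromptCalc.Expr)
    (hx : x ∉ E.fv) (hE : E.surPr = ∅) :
    -- closed terms
    (E.fv = ∅ → e.fv = ∅ →
      PromptCalc.StarBisimExpr
        (.app (.val (PromptCalc.lamVar x (E.plug (.val (.var x))))) e) (E.plug e) ∧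
      PromptCalc.CtxEquiv
        (.app (.val (PromptCalc.lamVar x (E.plug (.val (.var x))))) e) (E.plug e)) ∧
    -- open terms, compared through any abstraction of all their free variables
    (∀ xs : List ℕ, (∀ y ∈ E.fv ∪ e.fv, y ∈ xs) →
      PromptCalc.StarBisimExpr
        (PromptCalc.lamVars xs
          (.app (.val (PromptCalc.lamVar x (E.plug (.val (.var x))))) e))
        (PromptCalc.lamVars xs (E.plug e)) ∧
      PromptCalc.CtxEquiv
        (PromptCalc.lamVars xs
          (.app (.val (PromptCalc.lamVar x (E.plug (.val (.var x))))) e))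
        (PromptCalc.lamVars xs (E.plug e))) := by
  have h := PromptCalc.ExprRel.beta_omega hx hE e
  have hl := PromptCalc.fv_beta_omega x E e
  have hr : (E.plug e).fv ⊆ E.fv ∪ e.fv := (PromptCalc.ECtx.fv_plug e E).subset
  refine ⟨fun hE₀ he₀ => ?_, fun xs hxs => ?_⟩
  · rw [hE₀, he₀, Set.union_empty, Set.subset_empty_iff] at hl hr
    exact ⟨h.starBisimExpr hl hr, h.ctxEquiv hl hr⟩
  -- Abstraction over `xs` removes every variable listed there, and `xs` contains all the free
  -- variables of both terms.
  · have hclosed : ∀ f : PromptCalc.Expr, f.fv ⊆ E.fv ∪ e.fv →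
        (PromptCalc.lamVars xs f).fv = ∅ := fun f hf =>
      Set.eq_empty_iff_forall_notMem.2 fun n hn =>
        have hn := PromptCalc.fv_lamVars f xs hn
        hn.2 (hxs n (hf hn.1))
    exact ⟨(h.lamVars xs).starBisimExpr (hclosed _ hl) (hclosed _ hr),
      (h.lamVars xs).ctxEquiv (hclosed _ hl) (hclosed _ hr)⟩
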